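/- All objects are smooth ($C^\infty$) and all claims are local, at generic points (points of an open dense subset). Consider a system $\dot x=f(x,u)$ with state $x=(x^1,\dots,x^n)$ and input $u=(u^1,u^2)$, defined on an open set, and write $h_{[\alpha]}$ for the $\alpha$-th time derivative of $h$, i.e. the $\alpha$-fold Lie derivative along $f_u=f^i(x,u)\partial_{x^i}+\sum_{\alpha<N}u^j_{[\alpha+1]}\partial_{u^j_{[\alpha]}}$ on the space with coordinates $(x,u,u_{[1]},\dots,u_{[N]})$, $N$ sufficiently large. A pair $y=\varphi(x)=(\varphi^1(x),\varphi^2(x))$ is an *$x$-flat output* with multi-index $R=(r_1,r_2)$ if, locally around generic points, $x=F_x(\varphi^1,\dots,\varphi^1_{[r_1-1]},\varphi^2,\dots,\varphi^2_{[r_2-1]})$ and $u=F_u(\varphi^1,\dots,\varphi^1_{[r_1]},\varphi^2,\dots,\varphi^2_{[r_2]})$ with smooth $F_x,F_u$, where $\varphi^1_{[r_1]}$ and $\varphi^2_{[r_2]}$ really occur (are the highest derivatives). Its *differential difference* is $d=r_1+r_2-n$. The *$p$-fold prolongation of each input* is the system $\dot x=f(x,u),\ \dot u=u_{[1]},\dots,\dot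 u_{[p-1]}=u_{[p]}$ with state $(x,u,\dots,u_{[p-1]})$ and input $u_{[p]}$ (for $p=0$ the system itself). Two systems are *static feedback equivalent* if they are related by an invertible transformation $z=\Phi_x(x)$, $v=\Phi_u(x,u)$. The *general triangular form* (GTF) of dimension $m$ is, for integers $k_1,k_2\ge1$ with $k_1+k_2\le m$, $$\dot z^l=z^{l+1}\ (1\le l<k_1),\quad \dot z^{k_1}=v^1,\quad \dot z^l=z^{l+1}\ (k_1<l<k_1+k_2),$$ $$\dot z^l=a^l(z^1,\dots,z^{l+1})+b^l(z^1,\dots,z^{l+1})\,v^1\ (k_1+k_2\le l\le m-1),\quad \dot z^m=v^2,$$ where $b^{k_1+k_2}\neq0$ if $k_1+k_2<m$, and for each $l=k_1+k_2,\dots,m-1$ at least one of $\partial_{z^{l+1}}a^l\neq0$, $\partial_{z^{l+1}}b^l\neq0$ holds. **Theorem.** Let $y=(\varphi^1(x),\varphi^2(x))$ be an $x$-flat output of the two-input system $\dot x=f(x,u)$ with differential difference $d$. Then $0\le d\le n-2$, and: (a) if the system is control-affine, $\dot x=f_0(x)+g_1(x)u^1+g_2(x)u^2$, then at most $d$-fold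 prolongation of each input is needed: after the $d$-fold prolongation of each input the system is, at generic points, static feedback equivalent to the GTF, with the components of $y$ appearing as $\varphi^1=z^1$, $\varphi^2=z^{k_1+1}$; (b) in general at most $(d+1)$-fold prolongation is needed: after the $(d+1)$-fold prolongation of each input the system is, at generic points, static feedback equivalent to the GTF, again with $\varphi^1=z^1$, $\varphi^2=z^{k_1+1}$. -/

import Mathlib

open Set Filter Topology
open scoped ContDiff Manifold

/-! ### Systems, prolongations, jets -/

/-- The coordinate space of the state `x = (x¹, …, xⁿ)`. -/
abbrev StateSp (n : ℕ) : Type := Fin n → ℝ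

/-- The coordinate space of the input `u = (u¹, u²)`. -/
abbrev InputSp : Type := Fin 2 → ℝ

/-- The space with coordinates `(x, u, u_[1], …, u_[N])`. -/
abbrev JetSp (n N : ℕ) : Type := StateSp n × (Fin (N + 1) → InputSp)

/-- The state space of the `p`-fold prolongation, with coordinates `(x, u, …, u_[p-1])`. -/
abbrev ProlongedSp (n p : ℕ) : Type := StateSp n × (Fin p → InputSp)

/-- The right-hand side `f` of `ẋ = f(x, u)` is control-affine on `Ω`:
`f(x, u) = f₀(x) + g₁(x) u¹ + g₂(x) u²` with smooth vector fields `f₀, g₁, g₂`. -/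
def IsControlAffineOn {n : ℕ} (f : StateSp n × InputSp → StateSp n)
    (Ω : Set (StateSp n × InputSp)) : Prop :=
  ∃ f₀ g₁ g₂ : StateSp n → StateSp n,
    ContDiffOn ℝ ∞ f₀ (Prod.fst '' Ω) ∧ ContDiffOn ℝ ∞ g₁ (Prod.fst '' Ω) ∧
    ContDiffOn ℝ ∞ g₂ (Prod.fst '' Ω) ∧
    ∀ q ∈ Ω, f q = f₀ q.1 + q.2 0 • g₁ q.1 + q.2 1 • g₂ q.1

/-- The `p`-fold prolongation of each input of `ẋ = f(x, u)`: the system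
`ẋ = f(x, u), u̇ = u_[1], …, u̇_[p-1] = u_[p]` with state `(x, u, …, u_[p-1])` and input `u_[p]`.
For `p = 0` this is the system itself. -/
def prolong {n : ℕ} (f : StateSp n × InputSp → StateSp n) (p : ℕ) :
    ProlongedSp n p × InputSp → ProlongedSp n p :=
  fun q =>
    let w : Fin (p + 1) → InputSp := Fin.snoc (α := fun _ => InputSp) q.1.2 q.2
    (f (q.1.1, w 0), fun i => w i.succ)

/-- The point `((x, u, …, u_[p-1]), u_[p])` of the state-input space of the `p`-fold prolongation
below a point `(x, u, …, u_[N])`, where `p ≤ N`. -/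
def JetSp.trunc {n N : ℕ} (p : ℕ) (hp : p ≤ N) (ξ : JetSp n N) : ProlongedSp n p × InputSp :=
  ((ξ.1, fun i => ξ.2 ⟨i, by omega⟩), ξ.2 ⟨p, by omega⟩)

/-- The vector field `f_u = fⁱ(x, u) ∂_{xⁱ} + ∑_{α < N} u_[α+1] ∂_{u_[α]}`. -/
def totalField {n : ℕ} (f : StateSp n × InputSp → StateSp n) (N : ℕ) (ξ : JetSp n N) :
    JetSp n N :=
  (f (ξ.1, ξ.2 0), fun i => if h : (i : ℕ) + 1 < N + 1 then ξ.2 ⟨i + 1, h⟩ else 0)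

/-- The `k`-th time derivative `φ^j_[k] = L_{f_u}^k φ^j` of the component `φ^j` of a map `φ(x)`. It
is the true time derivative for `k ≤ N + 1`, since `φ^j_[k]` involves at most `u, …, u_[k-1]`. -/
noncomputable def outDeriv {n : ℕ} (f : StateSp n × InputSp → StateSp n) (N : ℕ)
    (φ : StateSp n → Fin 2 → ℝ) (j : Fin 2) (k : ℕ) : JetSp n N → ℝ :=
  (fun (h : JetSp n N → ℝ) (ξ : JetSp n N) => fderiv ℝ h ξ (totalField f N ξ))^[k]
    (fun ξ => φ ξ.1 j)

/-! ### Flat outputs -/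

/-- `O` is an open dense subset of `W` (its elements are the "generic points" of `W`). -/
def IsOpenDenseIn {α : Type*} [TopologicalSpace α] (O W : Set α) : Prop :=
  IsOpen O ∧ O ⊆ W ∧ W ⊆ closure O

/-- Around the point `ξ` the state and the input are smooth functions
`x = F_x(φ_[0,R-1])`, `u = F_u(φ_[0,R])` of the output `φ` and its time derivatives, and the
highest derivative `φ^j_[r_j]` of each component really occurs (only `F_u` can contain it).
A family indexed by `Σ j, Fin (R j)` is `φ_[0,R-1]`, and one by `Σ j, Fin (R j + 1)` is
`φ_[0,R]`. -/
def IsFlatAt {n N : ℕ} (f : StateSp n × InputSp → StateSp n) (φ : StateSp n → Fin 2 → ℝ)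
    (R : Fin 2 → ℕ) (ξ : JetSp n N) : Prop :=
  let yx : JetSp n N → ((Σ j : Fin 2, Fin (R j)) → ℝ) :=
    fun η s => outDeriv f N φ s.1 s.2 η
  let yu : JetSp n N → ((Σ j : Fin 2, Fin (R j + 1)) → ℝ) :=
    fun η s => outDeriv f N φ s.1 s.2 η
  ∃ (Yx : Set ((Σ j : Fin 2, Fin (R j)) → ℝ)) (Yu : Set ((Σ j : Fin 2, Fin (R j + 1)) → ℝ))
    (Fx : ((Σ j : Fin 2, Fin (R j)) → ℝ) → StateSp n)
    (Fu : ((Σ j : Fin 2, Fin (R j + 1)) → ℝ) → InputSp),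
    IsOpen Yx ∧ IsOpen Yu ∧ ContDiffOn ℝ ∞ Fx Yx ∧ ContDiffOn ℝ ∞ Fu Yu ∧
    (∀ᶠ η in 𝓝 ξ, yx η ∈ Yx ∧ yu η ∈ Yu ∧ η.1 = Fx (yx η) ∧ η.2 0 = Fu (yu η)) ∧
    ∀ j : Fin 2, fderiv ℝ Fu (yu ξ) (Pi.single ⟨j, Fin.last (R j)⟩ 1) ≠ 0

/-- `φ = (φ¹(x), φ²(x))` is an `x`-flat output of `ẋ = f(x, u)` on the (open) set `W`, with
multi-index `R = (r₁, r₂)`: the order `N` of the input derivatives is large enough, and the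
parametrization of state and input exists around every generic point of `W`. -/
def IsXFlatOutput {n N : ℕ} (f : StateSp n × InputSp → StateSp n) (φ : StateSp n → Fin 2 → ℝ)
    (R : Fin 2 → ℕ) (W : Set (JetSp n N)) : Prop :=
  (∀ j, R j ≤ N) ∧ ∃ O, IsOpenDenseIn O W ∧ ∀ ξ ∈ O, IsFlatAt f φ R ξ

/-- The differential difference `d = #R - n`. -/
def differentialDifference (n : ℕ) (R : Fin 2 → ℕ) : ℤ := (∑ j, (R j : ℤ)) - n

/-! ### The general triangular form -/

/-- The right-hand side of the general triangular form of dimension `m` with chains of length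
`k₁, k₂`. The coordinate `z^l` (`l = 1, …, m`) is `z i` with `i = l - 1`, so that the functions
`a^l, b^l` are `a i, b i`; only those with `k₁ + k₂ ≤ l ≤ m - 1` are used. -/
def gtfField (m k₁ k₂ : ℕ) (a b : Fin m → (Fin m → ℝ) → ℝ) :
    (Fin m → ℝ) × InputSp → (Fin m → ℝ) :=
  fun q i =>
    if h : (i : ℕ) + 1 < m then
      if (i : ℕ) + 1 = k₁ then q.2 0
      else if (i : ℕ) + 1 < k₁ + k₂ then q.1 ⟨i + 1, h⟩
      else a i q.1 + b i q.1 * q.2 0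
    else q.2 1

/-- The data `(m, k₁, k₂, a, b)` define a general triangular form on the open set `Z`: the chain
lengths are admissible, and for `l = k₁ + k₂, …, m - 1` the functions `a^l, b^l` are smooth, depend
on `z¹, …, z^{l+1}` only, and `∂a^l/∂z^{l+1} ≠ 0` and/or `∂b^l/∂z^{l+1} ≠ 0`; moreover
`b^{k₁+k₂} ≠ 0`. -/
structure IsGTFOn (m k₁ k₂ : ℕ) (a b : Fin m → (Fin m → ℝ) → ℝ) (Z : Set (Fin m → ℝ)) :
    Prop where
  one_le_left : 1 ≤ k₁
  one_le_right : 1 ≤ k₂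
  add_le : k₁ + k₂ ≤ m
  isOpen : IsOpen Z
  smooth : ∀ i : Fin m, k₁ + k₂ ≤ (i : ℕ) + 1 → (i : ℕ) + 1 < m →
    ContDiffOn ℝ ∞ (a i) Z ∧ ContDiffOn ℝ ∞ (b i) Z
  depends : ∀ i : Fin m, k₁ + k₂ ≤ (i : ℕ) + 1 → (i : ℕ) + 1 < m → ∀ z ∈ Z, ∀ z' ∈ Z,
    (∀ j : Fin m, (j : ℕ) ≤ (i : ℕ) + 1 → z j = z' j) → a i z = a i z' ∧ b i z = b i z'
  regular : ∀ (i : Fin m) (h : (i : ℕ) + 1 < m), k₁ + k₂ ≤ (i : ℕ) + 1 → ∀ z ∈ Z,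
    fderiv ℝ (a i) z (Pi.single ⟨i + 1, h⟩ 1) ≠ 0 ∨
      fderiv ℝ (b i) z (Pi.single ⟨i + 1, h⟩ 1) ≠ 0
  first_ne_zero : ∀ i : Fin m, k₁ + k₂ = (i : ℕ) + 1 → (i : ℕ) + 1 < m → ∀ z ∈ Z, b i z ≠ 0

/-- `z = Φ_x(x)`, `v = Φ_u(x, u)` is a static feedback transformation around `q₀ = (x₀, u₀)` which
takes the system `ẋ = F(x, u)` to `ż = G(z, v)`. -/
def IsStaticFeedbackAt {E E' : Type*} [NormedAddCommGroup E] [NormedSpace ℝ E]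
    [NormedAddCommGroup E'] [NormedSpace ℝ E'] (F : E × InputSp → E) (G : E' × InputSp → E')
    (Φx : E → E') (Φu : E × InputSp → InputSp) (q₀ : E × InputSp) : Prop :=
  IsLocalDiffeomorphAt 𝓘(ℝ, E) 𝓘(ℝ, E') ∞ Φx q₀.1 ∧
  IsLocalDiffeomorphAt 𝓘(ℝ, E × InputSp) 𝓘(ℝ, E' × InputSp) ∞
    (fun q : E × InputSp => (Φx q.1, Φu q)) q₀ ∧
  ∀ᶠ q in 𝓝 q₀, fderiv ℝ Φx q.1 (F q) = G (Φx q.1, Φu q)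

/-- Around the point `q₀`, the `p`-fold prolongation of `ẋ = f(x, u)` is static feedback equivalent
to the general triangular form such that `φ¹, φ²` appear as `z¹` and `z^{k₁+1}`. -/
def IsSFEToGTFAt {n : ℕ} (f : StateSp n × InputSp → StateSp n) (φ : StateSp n → Fin 2 → ℝ)
    (p : ℕ) (q₀ : ProlongedSp n p × InputSp) : Prop :=
  ∃ (k₁ k₂ : ℕ) (a b : Fin (n + 2 * p) → (Fin (n + 2 * p) → ℝ) → ℝ)
    (Z : Set (Fin (n + 2 * p) → ℝ))
    (Φx : ProlongedSp n p → (Fin (n + 2 * p) → ℝ))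
    (Φu : ProlongedSp n p × InputSp → InputSp),
    IsGTFOn (n + 2 * p) k₁ k₂ a b Z ∧ Φx q₀.1 ∈ Z ∧
    IsStaticFeedbackAt (prolong f p) (gtfField (n + 2 * p) k₁ k₂ a b) Φx Φu q₀ ∧
    ∀ᶠ s in 𝓝 q₀.1, ∀ i : Fin (n + 2 * p),
      ((i : ℕ) = 0 → Φx s i = φ s.1 0) ∧ ((i : ℕ) = k₁ → Φx s i = φ s.1 1)

/-- At generic points of `W`, the `p`-fold prolongation of `ẋ = f(x, u)` is static feedback
equivalent to the general triangular form with `φ¹, φ²` as `z¹` and `z^{k₁+1}`. -/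
def IsGenericallySFEToGTF {n N : ℕ} (f : StateSp n × InputSp → StateSp n)
    (φ : StateSp n → Fin 2 → ℝ) (p : ℕ) (W : Set (JetSp n N)) : Prop :=
  ∃ (hp : p ≤ N) (O : Set (JetSp n N)), IsOpenDenseIn O W ∧
    ∀ ξ ∈ O, IsSFEToGTFAt f φ p (ξ.trunc p hp)

/-! ### Lie derivatives and linear relations between differentials -/

/-! Everything is linear algebra with the differentials of the derivatives of the output. Write κ₁,
κ₂ for `κ 0`, `κ 1`, the orders at which the input first enters the derivatives of φ¹ and φ².
Testing the parametrization of u along the direction u_[M], M the larger of the r_j - κ_j, forces r₁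
- κ₁ = r₂ - κ₂ =: e (`exists_isRegularDomain`). If e ≥ 1, it also forces ∂φ²_[κ₂]/∂u = r ∂φ¹_[κ₁]/∂u
with r ≠ 0 (`exists_ratio`).

Let u^{c'} enter φ¹_[κ₁] and let u^c be the other input component, so that φ¹_[κ₁+l] can replace
u^{c'}_[l] as a coordinate. In these coordinates u^c does not enter φ²_[κ₂+s] for s < e. Otherwise
φ²_[κ₂+s+i] would have leading term u^c_[i] for all i, and F_u, which really contains φ²_[r₂], would
depend on u^c_[e-s] (`fderiv_out_one`). For e ≥ 1, u^c does enter φ²_[r₂], since otherwise u could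
not be recovered (`isLeadingAt`).

Hence dφ_[0,R-1] spans the same space as dx and the dφ¹_[κ₁+l], l < e. The former are independent
somewhere, because a relation could be Lie differentiated until it contains some φ^j_[r_j], which
flatness excludes (`not_hasRelation`, `exists_indepAt`). Counting gives r₁ + r₂ = n + e
(`sum_order`). So e = d and n = κ₁ + κ₂ + d with κ_j ≥ 1, which yields 0 ≤ d ≤ n - 2.

For p = d + i₀ with i₀ = 0 or 1, the n + 2p functions φ¹_[0,κ₁+p-1], φ²_[0,κ₂+p-1], u^c_[i₀], …,
u^c_[p-1] are coordinates of the prolonged state space. The only derivative that is not a pure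
integrator is φ²_[κ₂+p] = a + r φ¹_[κ₁+p], present for d ≥ 1. The leading terms of order p cancel in
a, and u^c_[i₀] is the one further coordinate in a and r, with a or r really depending on it. This
is the triangular form with v¹ = φ¹_[κ₁+p] and v² = u^c_[p], or v² = φ²_[κ₂+p] if d = 0
(`exists_isGTFSystem`, `isSFEToGTFAt`). -/

section LieDerivative

variable {E : Type*} [NormedAddCommGroup E] [NormedSpace ℝ E]

/-- The Lie derivative of a function along a vector field. -/
noncomputable def lieD (τ : E → E) (h : E → ℝ) : E → ℝ := fun ξ => fderiv ℝ h ξ (τ ξ)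

theorem contDiffOn_fderiv {F : Type*} [NormedAddCommGroup F] [NormedSpace ℝ F] {V : Set E}
    (hV : IsOpen V) {h : E → F} (hh : ContDiffOn ℝ ∞ h V) : ContDiffOn ℝ ∞ (fderiv ℝ h) V :=
  hh.fderiv_of_isOpen hV (by simp)

theorem contDiffOn_fderiv_apply {V : Set E} (hV : IsOpen V) {h : E → ℝ}
    (hh : ContDiffOn ℝ ∞ h V) (v : E) : ContDiffOn ℝ ∞ (fun η => fderiv ℝ h η v) V :=
  (contDiffOn_fderiv hV hh).clm_apply contDiffOn_const

theorem contDiffOn_lieD {V : Set E} (hV : IsOpen V) {τ : E → E} {h : E → ℝ}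
    (hτ : ContDiffOn ℝ ∞ τ V) (hh : ContDiffOn ℝ ∞ h V) : ContDiffOn ℝ ∞ (lieD τ h) V :=
  (contDiffOn_fderiv hV hh).clm_apply hτ

theorem ContDiffOn.differentiableAt_of_isOpen {F : Type*} [NormedAddCommGroup F]
    [NormedSpace ℝ F] {V : Set E} (hV : IsOpen V) {h : E → F} (hh : ContDiffOn ℝ ∞ h V) {ξ : E}
    (hξ : ξ ∈ V) : DifferentiableAt ℝ h ξ :=
  (hh.contDiffAt (hV.mem_nhds hξ)).differentiableAt (by simp)

theorem fderiv_fderiv_apply_comm {V : Set E} (hV : IsOpen V) {h : E → ℝ}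
    (hh : ContDiffOn ℝ ∞ h V) {ξ : E} (hξ : ξ ∈ V) (v w : E) :
    fderiv ℝ (fun η => fderiv ℝ h η v) ξ w = fderiv ℝ (fun η => fderiv ℝ h η w) ξ v := by
  have hd : DifferentiableAt ℝ (fderiv ℝ h) ξ :=
    (contDiffOn_fderiv hV hh).differentiableAt_of_isOpen hV hξ
  have key : ∀ a b : E, fderiv ℝ (fun η => fderiv ℝ h η a) ξ b
      = fderiv ℝ (fderiv ℝ h) ξ b a := fun a b => by
    rw [fderiv_clm_apply hd (differentiableAt_const a)]
    simp
  rw [key, key]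
  exact ((hh.contDiffAt (hV.mem_nhds hξ)).isSymmSndFDerivAt
    (by simpa using (WithTop.coe_le_coe.2 le_top : ((2 : ℕ∞) : ℕ∞ω) ≤ ((⊤ : ℕ∞) : ℕ∞ω)))) w v

/-- By symmetry of the second derivative, the second-order term is arranged so that v stays
constant. A relation for dh(v) valid on an open set can then be substituted before differentiating
along τ. -/
theorem fderiv_lieD {V : Set E} (hV : IsOpen V) {τ : E → E} {h : E → ℝ}
    (hτ : ContDiffOn ℝ ∞ τ V) (hh : ContDiffOn ℝ ∞ h V) {ξ : E} (hξ : ξ ∈ V) (v : E) :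
    fderiv ℝ (lieD τ h) ξ v =
      fderiv ℝ (fun η => fderiv ℝ h η v) ξ (τ ξ) + fderiv ℝ h ξ (fderiv ℝ τ ξ v) := by
  have hd : DifferentiableAt ℝ (fderiv ℝ h) ξ :=
    (contDiffOn_fderiv hV hh).differentiableAt_of_isOpen hV hξ
  rw [fderiv_fderiv_apply_comm hV hh hξ v (τ ξ),
    show lieD τ h = fun η => fderiv ℝ h η (τ η) from rfl, fderiv_clm_apply hd
    (hτ.differentiableAt_of_isOpen hV hξ), fderiv_clm_apply hd (differentiableAt_const _)]
  simp [add_comm]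

/-- The Lie derivative of a linear relation between differentials. -/
theorem fderiv_lieD_of_relation {ι : Type*} [Fintype ι] {V : Set E} (hV : IsOpen V) {τ : E → E}
    {h : E → ℝ} {g : ι → E → ℝ} {c : ι → E → ℝ} (hτ : ContDiffOn ℝ ∞ τ V)
    (hh : ContDiffOn ℝ ∞ h V) (hg : ∀ i, ContDiffOn ℝ ∞ (g i) V)
    (hc : ∀ i, ContDiffOn ℝ ∞ (c i) V)
    (hrel : ∀ η ∈ V, ∀ v, fderiv ℝ h η v = ∑ i, c i η * fderiv ℝ (g i) η v)
    {ξ : E} (hξ : ξ ∈ V) (v : E) :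
    fderiv ℝ (lieD τ h) ξ v = ∑ i, (lieD τ (c i) ξ * fderiv ℝ (g i) ξ v +
      c i ξ * fderiv ℝ (lieD τ (g i)) ξ v) := by
  have e : (fun η => fderiv ℝ h η v) =ᶠ[𝓝 ξ] fun η => ∑ i, c i η * fderiv ℝ (g i) η v := by
    filter_upwards [hV.mem_nhds hξ] with η hη using hrel η hη v
  have hcd := fun i => (hc i).differentiableAt_of_isOpen hV hξ
  have hgd := fun i => (contDiffOn_fderiv_apply hV (hg i) v).differentiableAt_of_isOpen hV hξ
  rw [fderiv_lieD hV hτ hh hξ, e.fderiv_eq, hrel ξ hξ,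
    fderiv_fun_sum fun i _ => (hcd i).fun_mul (hgd i)]
  simp only [sum_apply, ← Finset.sum_add_distrib]
  refine Finset.sum_congr rfl fun i _ => ?_
  rw [fderiv_lieD hV hτ (hg i) hξ, fderiv_fun_mul (hcd i) (hgd i)]
  simp [lieD]
  ring

/-! ### Independence of differentials -/

/-- The differentials of the functions `g i` are independent at `ξ`. -/
def IndepAt {ι : Type*} (g : ι → E → ℝ) (ξ : E) : Prop :=
  ∀ y : ι → ℝ, ∃ v : E, ∀ i, fderiv ℝ (g i) ξ v = y i

/-- Near a point of independence, there are smooth dual vector fields. -/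
theorem IndepAt.exists_dual {ι : Type*} [Fintype ι] [DecidableEq ι] {V : Set E} (hV : IsOpen V)
    {g : ι → E → ℝ} (hg : ∀ i, ContDiffOn ℝ ∞ (g i) V) {ξ : E} (hξ : ξ ∈ V)
    (hi : IndepAt g ξ) :
    ∃ U ⊆ V, IsOpen U ∧ ξ ∈ U ∧ ∃ e : ι → E → E, (∀ i, ContDiffOn ℝ ∞ (e i) U) ∧
      ∀ η ∈ U, ∀ i j, fderiv ℝ (g i) η (e j η) = if i = j then 1 else 0 := by
  -- Constant vectors dual at ξ. The matrix `G η` of their pairings with the differentials at η is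
  -- the identity at ξ, hence invertible nearby; its inverse corrects them to dual fields.
  choose e₀ he₀ using fun j : ι => hi (Pi.single j 1)
  let L : (ι → ℝ) →L[ℝ] E := ∑ j, (ContinuousLinearMap.proj j).smulRight (e₀ j)
  let G : E → (ι → ℝ) →L[ℝ] (ι → ℝ) := fun η =>
    (ContinuousLinearMap.pi fun i => fderiv ℝ (g i) η).comp L
  have hL : ∀ y, L y = ∑ j, y j • e₀ j := fun y => by simp [L]
  have hGξ : G ξ = ContinuousLinearMap.id ℝ _ := by
    ext y i
    simp [G, hL, he₀, Pi.single_apply]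
  have hpi : ContDiffOn ℝ ∞ (fun η => ContinuousLinearMap.pi fun i => fderiv ℝ (g i) η :
      E → E →L[ℝ] (ι → ℝ)) V := by
    have : (fun η => ContinuousLinearMap.pi fun i => fderiv ℝ (g i) η :
      E → E →L[ℝ] (ι → ℝ)) = fun η => ∑ i, (ContinuousLinearMap.toSpanSingleton ℝ
        (Pi.single i (1 : ℝ) : ι → ℝ)).comp (fderiv ℝ (g i) η) := by
      funext η
      ext v i
      simp [Finset.sum_apply, Pi.single_apply]
    rw [this]
    exact ContDiffOn.sum fun i _ => contDiffOn_const.clm_comp (contDiffOn_fderiv hV (hg i))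
  have hG : ContDiffOn ℝ ∞ G V := hpi.clm_comp contDiffOn_const
  have hopen : IsOpen {T : (ι → ℝ) →L[ℝ] (ι → ℝ) | IsUnit T} := Units.isOpen
  refine ⟨V ∩ G ⁻¹' {T | IsUnit T}, inter_subset_left,
    hG.continuousOn.isOpen_inter_preimage hV hopen, ⟨hξ, ?_⟩, fun j η =>
      L (Ring.inverse (G η) (Pi.single j 1)), fun j => ?_, ?_⟩
  · simp only [mem_preimage, mem_ofPred_eq, hGξ]
    exact isUnit_one
  · refine L.contDiff.comp_contDiffOn (ContDiffOn.clm_apply ?_ contDiffOn_const)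
    intro η hη
    obtain ⟨u, hu⟩ := hη.2
    have h1 : ContDiffAt ℝ ∞ Ring.inverse (G η) := by
      rw [← hu]; exact contDiffAt_ringInverse ℝ u
    exact h1.comp_contDiffWithinAt η ((hG.mono inter_subset_left) η hη)
  · intro η hη i j
    have h1 : G η * Ring.inverse (G η) = 1 := Ring.mul_inverse_cancel _ hη.2
    have h2 := congrArg (fun T : (ι → ℝ) →L[ℝ] (ι → ℝ) => T (Pi.single j 1) i) h1
    simpa [G, Pi.single_apply] using h2

theorem indepAt_of_dual {ι : Type*} [Fintype ι] [DecidableEq ι] {g : ι → E → ℝ} {η : E}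
    {e : ι → E} (he : ∀ i j, fderiv ℝ (g i) η (e j) = if i = j then 1 else 0) :
    IndepAt g η := fun y => ⟨∑ j, y j • e j, fun i => by simp [he]⟩

/-- A differential in the span of independent ones is a unique smooth linear combination. -/
theorem IndepAt.exists_coeff {ι : Type*} [Fintype ι] {V : Set E} (hV : IsOpen V)
    {g : ι → E → ℝ} (hg : ∀ i, ContDiffOn ℝ ∞ (g i) V) {h : E → ℝ} (hh : ContDiffOn ℝ ∞ h V)
    {ξ : E} (hξ : ξ ∈ V) (hi : IndepAt g ξ)
    (hker : ∀ η ∈ V, ∀ v, (∀ i, fderiv ℝ (g i) η v = 0) → fderiv ℝ h η v = 0) :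
    ∃ U ⊆ V, IsOpen U ∧ ξ ∈ U ∧ ∃ c : ι → E → ℝ, (∀ i, ContDiffOn ℝ ∞ (c i) U) ∧
      ∀ η ∈ U, ∀ v, fderiv ℝ h η v = ∑ i, c i η * fderiv ℝ (g i) η v := by
  classical
  obtain ⟨U, hUV, hU, hξU, e, he, hdual⟩ := hi.exists_dual hV hg hξ
  refine ⟨U, hUV, hU, hξU, fun i η => fderiv ℝ h η (e i η), fun i =>
    ((contDiffOn_fderiv hV hh).mono hUV).clm_apply (he i), fun η hη v => ?_⟩
  -- Subtracting from v its components along the dual fields leaves a vector in the common kernel.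
  have := hker η (hUV hη) (v - ∑ j, fderiv ℝ (g j) η v • e j η) fun i => by
    simp [map_sub, map_sum, hdual η hη]
  rw [map_sub, sub_eq_zero, map_sum] at this
  rw [this]
  exact Finset.sum_congr rfl fun i _ => by simp [mul_comm]

/-- Either the differentials of a finite family are independent somewhere, or they satisfy a
nontrivial smooth linear relation on some open set. -/
theorem exists_indepAt_or_relation {ι : Type*} [Fintype ι] {V : Set E} (hV : IsOpen V)
    (hne : V.Nonempty) {g : ι → E → ℝ} (hg : ∀ i, ContDiffOn ℝ ∞ (g i) V) :
    (∃ η ∈ V, IndepAt g η) ∨ ∃ U ⊆ V, IsOpen U ∧ U.Nonempty ∧ ∃ c : ι → E → ℝ,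
      (∀ i, ContDiffOn ℝ ∞ (c i) U) ∧ (∃ i, ∀ η ∈ U, c i η = -1) ∧
      ∀ η ∈ U, ∀ v, ∑ i, c i η * fderiv ℝ (g i) η v = 0 := by
  classical
  by_contra! hcon
  obtain ⟨hno, hrel⟩ := hcon
  have main : ∀ S : Finset ι, ∃ U ⊆ V, IsOpen U ∧ U.Nonempty ∧ ∀ η ∈ U,
      IndepAt (fun i : S => g i) η := by
    intro S
    induction S using Finset.induction with
    | empty => exact ⟨V, subset_rfl, hV, hne, fun η _ y => ⟨0, fun i => by
        exact absurd i.2 (Finset.notMem_empty _)⟩⟩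
    | insert i S hiS ih =>
      obtain ⟨U, hUV, hU, ⟨ξ, hξ⟩, hind⟩ := ih
      have hgU := fun i => (hg i).mono hUV
      -- If dg_i lies in the span of the others on all of U, it is a smooth combination of them, a
      -- relation with coefficient -1 at i. Otherwise it is independent of them at some point, and
      -- independence is an open condition.
      by_cases hk : ∀ η ∈ U, ∀ v, (∀ j : S, fderiv ℝ (g j) η v = 0) → fderiv ℝ (g i) η v = 0
      · obtain ⟨U', hU'U, hU', hξU', c, hc, hcr⟩ :=
          (hind ξ hξ).exists_coeff hU (fun j : S => hgU j) (hgU i) hξ hk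
        obtain ⟨η, hη, v, hv⟩ := hrel U' (hU'U.trans hUV) hU' ⟨ξ, hξU'⟩
          (fun j => if hj : j ∈ S then c ⟨j, hj⟩ else if j = i then fun _ => -1 else fun _ => 0)
          (fun j => by
            split_ifs
            · exact hc _
            · exact contDiffOn_const
            · exact contDiffOn_const)
          ⟨i, fun η _ => by simp [hiS]⟩
        refine absurd ?_ hv
        rw [← Finset.sum_subset (Finset.subset_univ (insert i S)), Finset.sum_insert hiS,
          ← Finset.sum_coe_sort S, hcr η hη v]
        · simp [hiS]
        · intro j _ hj
          simp only [Finset.mem_insert, not_or] at hj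
          simp [hj.1, hj.2]
      · push Not at hk
        obtain ⟨η, hη, v, hv, hvi⟩ := hk
        have hη' : IndepAt (fun j : (insert i S : Finset ι) => g j) η := by
          intro y
          obtain ⟨w, hw⟩ := hind η hη fun j => y ⟨j, Finset.mem_insert_of_mem j.2⟩
          refine ⟨w + ((y ⟨i, Finset.mem_insert_self i S⟩ - fderiv ℝ (g i) η w) /
            fderiv ℝ (g i) η v) • v, fun ⟨j, hj⟩ => ?_⟩
          rcases Finset.mem_insert.1 hj with rfl | hjS
          · simp [hvi]
          · simpa [hv ⟨j, hjS⟩] using hw ⟨j, hjS⟩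
        obtain ⟨U', hU'U, hU', hηU', e, -, he⟩ :=
          hη'.exists_dual hU (fun j : (insert i S : Finset ι) => hgU j) hη
        exact ⟨U', hU'U.trans hUV, hU', ⟨η, hηU'⟩, fun ζ hζ => indepAt_of_dual (he ζ hζ)⟩
  obtain ⟨U, hUV, -, ⟨ξ, hξ⟩, hind⟩ := main Finset.univ
  refine hno ξ (hUV hξ) fun y => ?_
  obtain ⟨v, hv⟩ := hind ξ hξ fun i => y i
  exact ⟨v, fun i => hv ⟨i, Finset.mem_univ i⟩⟩

/-- The number of independent differentials is at most that of a family whose common kernel is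
contained in theirs. -/
theorem IndepAt.card_le {ι κ : Type*} [Fintype ι] [Fintype κ] [FiniteDimensional ℝ E]
    {g : ι → E → ℝ} {g' : κ → E → ℝ} {ξ : E} (hi : IndepAt g ξ)
    (hker : ∀ v, (∀ i, fderiv ℝ (g' i) ξ v = 0) → ∀ i, fderiv ℝ (g i) ξ v = 0) :
    Fintype.card ι ≤ Fintype.card κ := by
  let A : E →ₗ[ℝ] ι → ℝ := LinearMap.pi fun i => (fderiv ℝ (g i) ξ).toLinearMap
  let B : E →ₗ[ℝ] κ → ℝ := LinearMap.pi fun i => (fderiv ℝ (g' i) ξ).toLinearMap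
  have hA : Function.Surjective A := fun y => (hi y).imp fun v hv => funext hv
  have hAB : LinearMap.ker B ≤ LinearMap.ker A := fun v hv => by
    have : ∀ i, fderiv ℝ (g' i) ξ v = 0 := fun i => congrFun (LinearMap.mem_ker.1 hv) i
    exact LinearMap.mem_ker.2 (funext (hker v this))
  -- Rank-nullity for both families: a smaller kernel means a larger rank.
  have h1 := A.finrank_range_add_finrank_ker
  have h2 := B.finrank_range_add_finrank_ker
  have h3 := Submodule.finrank_mono hAB
  have h4 := (LinearMap.range B).finrank_le
  rw [LinearMap.range_eq_top.2 hA, finrank_top, Module.finrank_fintype_fun_eq_card] at h1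
  rw [Module.finrank_fintype_fun_eq_card] at h4
  omega

end LieDerivative

/-! ### Jets: order of a function, leading terms of the output derivatives -/

section Jets

variable {n N : ℕ}

/-- The coordinate `u_[l]` of the jet space, which is `0` for `l > N`. -/
noncomputable def jetU (l : ℕ) : JetSp n N →L[ℝ] InputSp :=
  if h : l < N + 1 then
    (ContinuousLinearMap.proj (⟨l, h⟩ : Fin (N + 1))).comp (ContinuousLinearMap.snd ℝ _ _)
  else 0

theorem jetU_of_lt {l : ℕ} (h : l < N + 1) (v : JetSp n N) : jetU l v = v.2 ⟨l, h⟩ := by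
  simp [jetU, h]

theorem jetU_of_ge {l : ℕ} (h : N + 1 ≤ l) (v : JetSp n N) : jetU l v = 0 := by
  simp [jetU, Nat.not_lt.2 h]

theorem jetU_zero (v : JetSp n N) : jetU 0 v = v.2 0 := jetU_of_lt (Nat.succ_pos N) v

/-- The tangent vector with `u_[l]`-component `t`. -/
def jetSingle (l : ℕ) (t : InputSp) : JetSp n N := (0, fun i => if (i : ℕ) = l then t else 0)

@[simp] theorem jetSingle_fst (l : ℕ) (t : InputSp) : (jetSingle l t : JetSp n N).1 = 0 := rfl

theorem jetU_jetSingle {l m : ℕ} (hl : l ≤ N) (t : InputSp) :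
    jetU m (jetSingle l t : JetSp n N) = if m = l then t else 0 := by
  by_cases hm : m < N + 1
  · rw [jetU_of_lt hm]; rfl
  · rw [jetU_of_ge (by omega), if_neg (by omega)]

theorem jetSingle_add (l : ℕ) (s t : InputSp) :
    (jetSingle l (s + t) : JetSp n N) = jetSingle l s + jetSingle l t := by
  ext i
  · simp
  · simp only [jetSingle, Prod.snd_add, Pi.add_apply]; split_ifs <;> simp

theorem jetSingle_smul (l : ℕ) (r : ℝ) (t : InputSp) :
    (jetSingle l (r • t) : JetSp n N) = r • jetSingle l t := by
  ext i
  · simp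
  · simp only [jetSingle, Prod.smul_snd, Pi.smul_apply]; split_ifs <;> simp

/-- The cut-off is consistent: at l = N both sides vanish, so the shift rule needs no bound on l. -/
theorem jetU_totalField (f : StateSp n × InputSp → StateSp n) (l : ℕ) (ξ : JetSp n N) :
    jetU l (totalField f N ξ) = jetU (l + 1) ξ := by
  by_cases hl : l < N + 1
  · rw [jetU_of_lt hl]
    by_cases hl' : l + 1 < N + 1
    · rw [jetU_of_lt hl']; simp [totalField, show l < N by omega]
    · rw [jetU_of_ge (by omega)]; simp [totalField, show ¬ l < N by omega]
  · rw [jetU_of_ge (by omega), jetU_of_ge (by omega)]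

/-- An open subset of the jet space on which the system and the output are smooth. -/
structure IsSmoothDomain (f : StateSp n × InputSp → StateSp n) (φ : StateSp n → Fin 2 → ℝ)
    (V : Set (JetSp n N)) : Prop where
  isOpen : IsOpen V
  field_smooth : ContDiffOn ℝ ∞ (fun η : JetSp n N => f (η.1, η.2 0)) V
  field_diff : ∀ η ∈ V, DifferentiableAt ℝ f (η.1, η.2 0)
  out_smooth : ContDiffOn ℝ ∞ (fun η : JetSp n N => φ η.1) V
  out_diff : ∀ η ∈ V, DifferentiableAt ℝ φ η.1

theorem IsSmoothDomain.mono {f : StateSp n × InputSp → StateSp n} {φ : StateSp n → Fin 2 → ℝ}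
    {V V' : Set (JetSp n N)} (h : IsSmoothDomain f φ V) (hV' : IsOpen V') (hsub : V' ⊆ V) :
    IsSmoothDomain f φ V' :=
  ⟨hV', h.field_smooth.mono hsub, fun η hη => h.field_diff η (hsub hη), h.out_smooth.mono hsub,
    fun η hη => h.out_diff η (hsub hη)⟩

variable {f : StateSp n × InputSp → StateSp n} {φ : StateSp n → Fin 2 → ℝ} {V : Set (JetSp n N)}

theorem IsSmoothDomain.totalField (h : IsSmoothDomain f φ V) :
    ContDiffOn ℝ ∞ (totalField f N) V := by
  refine h.field_smooth.prodMk (ContDiff.contDiffOn (contDiff_pi.2 fun i => ?_))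
  by_cases hi : (i : ℕ) + 1 < N + 1
  · simp only [hi, dite_true]; fun_prop
  · simp only [hi, dite_false]; exact contDiff_const

theorem IsSmoothDomain.fderiv_totalField_fst (h : IsSmoothDomain f φ V) {η : JetSp n N}
    (hη : η ∈ V) (v : JetSp n N) :
    (fderiv ℝ (_root_.totalField f N) η v).1 = fderiv ℝ f (η.1, η.2 0) (v.1, jetU 0 v) := by
  have hd := h.totalField.differentiableAt_of_isOpen h.isOpen hη
  have h1 : HasFDerivAt (fun ζ : JetSp n N => (_root_.totalField f N ζ).1)
      ((ContinuousLinearMap.fst ℝ _ _).comp (fderiv ℝ (_root_.totalField f N) η)) η :=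
    hd.hasFDerivAt.fst
  have h2 : HasFDerivAt (fun ζ : JetSp n N => f (ζ.1, jetU 0 ζ))
      ((fderiv ℝ f (η.1, jetU 0 η)).comp ((ContinuousLinearMap.fst ℝ _ _).prod (jetU 0))) η :=
    HasFDerivAt.comp (f := fun ζ : JetSp n N => (ζ.1, jetU 0 ζ)) η
      (by rw [jetU_zero]; exact (h.field_diff η hη).hasFDerivAt)
      (hasFDerivAt_fst.prodMk (jetU 0).hasFDerivAt)
  have h3 : (fun ζ : JetSp n N => f (ζ.1, jetU 0 ζ)) =
      fun ζ => (_root_.totalField f N ζ).1 := by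
    funext ζ; rw [jetU_zero]; rfl
  rw [h3] at h2
  have := congrArg (fun T => T v) (h1.unique h2)
  simpa [jetU_zero] using this

theorem IsSmoothDomain.jetU_fderiv_totalField (h : IsSmoothDomain f φ V) {η : JetSp n N}
    (hη : η ∈ V) (l : ℕ) (v : JetSp n N) :
    jetU l (fderiv ℝ (_root_.totalField f N) η v) = jetU (l + 1) v := by
  have hd := h.totalField.differentiableAt_of_isOpen h.isOpen hη
  have h1 : HasFDerivAt (fun ζ : JetSp n N => jetU l (_root_.totalField f N ζ))
      ((jetU l).comp (fderiv ℝ (_root_.totalField f N) η)) η :=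
    (jetU l).hasFDerivAt.comp η hd.hasFDerivAt
  simp only [jetU_totalField] at h1
  exact congrArg (fun T => T v) (h1.unique (jetU (l + 1)).hasFDerivAt)

theorem outDeriv_succ (j : Fin 2) (k : ℕ) :
    outDeriv f N φ j (k + 1) = lieD (totalField f N) (outDeriv f N φ j k) :=
  Function.iterate_succ_apply' _ _ _

theorem IsSmoothDomain.outDeriv (h : IsSmoothDomain f φ V) (j : Fin 2) (k : ℕ) :
    ContDiffOn ℝ ∞ (outDeriv f N φ j k) V := by
  induction k with
  | zero => exact contDiffOn_pi.1 h.out_smooth j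
  | succ k ih => rw [outDeriv_succ]; exact contDiffOn_lieD h.isOpen h.totalField ih

/-! ### Order of a function and leading terms -/

/-- `h` depends on `x, u, …, u_[i-1]` only, in differential form. -/
def HasOrd (h : JetSp n N → ℝ) (i : ℕ) (V : Set (JetSp n N)) : Prop :=
  ∀ η ∈ V, ∀ v : JetSp n N, v.1 = 0 → (∀ l < i, jetU l v = 0) → fderiv ℝ h η v = 0

theorem HasOrd.mono_order {h : JetSp n N → ℝ} {i i' : ℕ} (ho : HasOrd h i V) (hi : i ≤ i') :
    HasOrd h i' V :=
  fun η hη v hv hl => ho η hη v hv fun l hl' => hl l (hl'.trans_le hi)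

theorem HasOrd.mono_set {h : JetSp n N → ℝ} {i : ℕ} {V' : Set (JetSp n N)} (ho : HasOrd h i V)
    (hV' : V' ⊆ V) : HasOrd h i V' := fun η hη => ho η (hV' hη)

/-- For such a constant direction v, dh(v) vanishes identically near η, so the second-order term of
`fderiv_lieD` drops out. -/
theorem HasOrd.fderiv_lieD_eq (hV : IsSmoothDomain f φ V) {h : JetSp n N → ℝ}
    (hh : ContDiffOn ℝ ∞ h V) {i : ℕ} (ho : HasOrd h i V) {η : JetSp n N} (hη : η ∈ V)
    {v : JetSp n N} (hv : v.1 = 0) (hl : ∀ l < i, jetU l v = 0) :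
    fderiv ℝ (lieD (totalField f N) h) η v =
      fderiv ℝ h η (fderiv ℝ (totalField f N) η v) := by
  rw [fderiv_lieD hV.isOpen hV.totalField hh hη]
  have : (fun ζ => fderiv ℝ h ζ v) =ᶠ[𝓝 η] fun _ => 0 := by
    filter_upwards [hV.isOpen.mem_nhds hη] with ζ hζ using ho ζ hζ v hv hl
  rw [this.fderiv_eq]
  simp

/-- The linearization of the total field shifts u_[l+1] to u_[l], and its x-component sees only x
and u. A direction without components below order i + 1 is thus sent to one without components below
order i. -/
theorem HasOrd.lieD (hV : IsSmoothDomain f φ V) {h : JetSp n N → ℝ}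
    (hh : ContDiffOn ℝ ∞ h V) {i : ℕ} (ho : HasOrd h i V) :
    HasOrd (lieD (_root_.totalField f N) h) (i + 1) V := by
  intro η hη v hv hl
  rw [ho.fderiv_lieD_eq hV hh hη hv fun l hl' => hl l (by omega)]
  refine ho η hη _ ?_ fun l hl' => ?_
  · rw [hV.fderiv_totalField_fst hη, hv, hl 0 (by omega)]
    exact map_zero _
  · rw [hV.jetU_fderiv_totalField hη]
    exact hl _ (by omega)

theorem HasOrd.fderiv_apply (hV : IsOpen V) {h : JetSp n N → ℝ}
    (hh : ContDiffOn ℝ ∞ h V) {i : ℕ} (ho : HasOrd h i V) (t : JetSp n N) :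
    HasOrd (fun η => fderiv ℝ h η t) i V := by
  intro η hη v hv hl
  rw [fderiv_fderiv_apply_comm hV hh hη]
  have : (fun ζ => fderiv ℝ h ζ v) =ᶠ[𝓝 η] fun _ => 0 := by
    filter_upwards [hV.mem_nhds hη] with ζ hζ using ho ζ hζ v hv hl
  rw [this.fderiv_eq]
  simp

theorem IsSmoothDomain.hasOrd_outDeriv_zero (hV : IsSmoothDomain f φ V) (j : Fin 2) :
    HasOrd (_root_.outDeriv f N φ j 0) 0 V := by
  intro η hη v hv _
  have h1 : HasFDerivAt (fun ζ : JetSp n N => φ ζ.1 j) _ η :=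
    hasFDerivAt_pi'.1 ((hV.out_diff η hη).hasFDerivAt.comp η hasFDerivAt_fst) j
  rw [show _root_.outDeriv f N φ j 0 = fun ζ : JetSp n N => φ ζ.1 j from rfl, h1.fderiv]
  simp [hv]

/-- The first `κ` derivatives of `φ^j` do not depend on the inputs. -/
def IsInputFree (f : StateSp n × InputSp → StateSp n) (φ : StateSp n → Fin 2 → ℝ) (j : Fin 2)
    (κ : ℕ) (V : Set (JetSp n N)) : Prop :=
  ∀ k < κ, HasOrd (outDeriv f N φ j k) 0 V

variable {j : Fin 2} {κ : ℕ}

theorem IsInputFree.hasOrd (hV : IsSmoothDomain f φ V) (hκ : IsInputFree f φ j κ V)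
    (hpos : 1 ≤ κ) (i : ℕ) : HasOrd (outDeriv f N φ j (κ + i)) (i + 1) V := by
  induction i with
  | zero =>
    obtain ⟨m, rfl⟩ : ∃ m, κ = m + 1 := ⟨κ - 1, by omega⟩
    rw [add_zero, outDeriv_succ]
    exact (hκ m (by omega)).lieD hV (hV.outDeriv j m)
  | succ i ih =>
    rw [← add_assoc, outDeriv_succ]
    exact ih.lieD hV (hV.outDeriv j _)

theorem IsInputFree.hasOrd_of_lt (hV : IsSmoothDomain f φ V) (hκ : IsInputFree f φ j κ V)
    (hpos : 1 ≤ κ) {k i : ℕ} (hk : k < κ + i) : HasOrd (outDeriv f N φ j k) i V := by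
  by_cases hlt : k < κ
  · exact (hκ k hlt).mono_order (Nat.zero_le _)
  · obtain ⟨m, rfl⟩ := Nat.exists_eq_add_of_le (Nat.not_lt.1 hlt)
    exact (hκ.hasOrd hV hpos m).mono_order (by omega)

/-- The leading term of `φ^j_[κ+i]` is that of `φ^j_[κ]`. -/
theorem IsInputFree.fderiv_outDeriv (hV : IsSmoothDomain f φ V) (hκ : IsInputFree f φ j κ V)
    (hpos : 1 ≤ κ) {i : ℕ} (hi : i ≤ N) {η : JetSp n N} (hη : η ∈ V) {v : JetSp n N}
    (hv : v.1 = 0) (hl : ∀ l < i, jetU l v = 0) :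
    fderiv ℝ (outDeriv f N φ j (κ + i)) η v =
      fderiv ℝ (outDeriv f N φ j κ) η (jetSingle 0 (jetU i v)) := by
  induction i generalizing v with
  | zero =>
    rw [add_zero, ← sub_eq_zero, ← map_sub]
    refine (hκ.hasOrd hV hpos 0) η hη _ (by simp [hv]) fun l hl' => ?_
    obtain rfl : l = 0 := by omega
    simp [jetU_jetSingle]
  | succ i ih =>
    rw [← add_assoc, outDeriv_succ, (hκ.hasOrd hV hpos i).fderiv_lieD_eq hV (hV.outDeriv j _) hη hv
      (fun l hl' => hl l hl'), ih (by omega), hV.jetU_fderiv_totalField hη]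
    · rw [hV.fderiv_totalField_fst hη, hv, hl 0 (by omega)]
      exact map_zero _
    · intro l hl'
      rw [hV.jetU_fderiv_totalField hη]
      exact hl _ (by omega)

/-- On some open subset, `φ^j` has a relative degree `κ ≤ r` with a fixed input component entering
`φ^j_[κ]`, or `φ^j, …, φ^j_[r]` are functions of the state. -/
theorem exists_relativeDegree (hV : IsSmoothDomain f φ V) (hne : V.Nonempty) (j : Fin 2) (r : ℕ) :
    ∃ V' ⊆ V, IsOpen V' ∧ V'.Nonempty ∧ ∃ κ, 1 ≤ κ ∧ κ ≤ r + 1 ∧ IsInputFree f φ j κ V' ∧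
      (κ = r + 1 ∨ ∃ c : Fin 2, ∀ η ∈ V',
        fderiv ℝ (outDeriv f N φ j κ) η (jetSingle 0 (Pi.single c 1)) ≠ 0) := by
  -- Induction on the number m of derivatives known to be input-free; the first failure gives the
  -- relative degree.
  have main : ∀ m, 1 ≤ m → IsInputFree f φ j m V ∨
      ∃ V' ⊆ V, IsOpen V' ∧ V'.Nonempty ∧ ∃ κ, 1 ≤ κ ∧ κ < m ∧ IsInputFree f φ j κ V' ∧
      ∃ c : Fin 2, ∀ η ∈ V',
        fderiv ℝ (outDeriv f N φ j κ) η (jetSingle 0 (Pi.single c 1)) ≠ 0 := by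
    intro m hm
    induction m, hm using Nat.le_induction with
    | base =>
      left
      intro k hk
      obtain rfl : k = 0 := by omega
      exact hV.hasOrd_outDeriv_zero j
    | succ m hm ih =>
      rcases ih with hfree | ⟨V', h1, h2, h3, κ, h4, h5, h6⟩
      · by_cases hm0 : HasOrd (outDeriv f N φ j m) 0 V
        · left
          intro k hk
          rcases Nat.lt_succ_iff_lt_or_eq.1 hk with h | rfl
          · exact hfree k h
          · exact hm0
        · right
          unfold HasOrd at hm0
          push Not at hm0
          obtain ⟨η, hη, v, hv, -, hvne⟩ := hm0
          have h1 := hfree.fderiv_outDeriv hV hm (Nat.zero_le N) hη hv (by simp)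
          rw [add_zero] at h1
          obtain ⟨c, hc⟩ : ∃ c : Fin 2,
              fderiv ℝ (outDeriv f N φ j m) η (jetSingle 0 (Pi.single c 1)) ≠ 0 := by
            by_contra! hcon
            apply hvne
            rw [h1, show jetU 0 v = (jetU 0 v 0) • (Pi.single 0 1 : InputSp) +
                (jetU 0 v 1) • (Pi.single 1 1 : InputSp) by
              ext i; fin_cases i <;> simp, jetSingle_add, jetSingle_smul, jetSingle_smul]
            simp [hcon]
          refine ⟨V ∩ (fun η => fderiv ℝ (outDeriv f N φ j m) η
            (jetSingle 0 (Pi.single c 1))) ⁻¹' {0}ᶜ, inter_subset_left, ?_, ⟨η, hη, hc⟩, m, hm,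
            by omega, fun k hk => (hfree k hk).mono_set inter_subset_left, c, fun η hη => hη.2⟩
          exact (contDiffOn_fderiv_apply hV.isOpen (hV.outDeriv j m)
            _).continuousOn.isOpen_inter_preimage hV.isOpen isOpen_compl_singleton
      · exact Or.inr ⟨V', h1, h2, h3, κ, h4, by omega, h6⟩
  -- κ = r + 1 is the default value, when no derivative up to order r contains the input.
  rcases main (r + 1) (by omega) with h | ⟨V', h1, h2, h3, κ, h4, h5, h6, h7⟩
  · exact ⟨V, subset_rfl, hV.isOpen, hne, r + 1, by omega, le_rfl, h, Or.inl rfl⟩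
  · exact ⟨V', h1, h2, h3, κ, h4, by omega, h6, Or.inr h7⟩

end Jets

/-! ### Infinitesimal consequences of flatness -/

section Flat

variable {n N : ℕ} {f : StateSp n × InputSp → StateSp n} {φ : StateSp n → Fin 2 → ℝ}
  {R : Fin 2 → ℕ}

/-- The differentials of the state and of the input are combinations of those of the output
derivatives `φ_[0,R-1]` and `φ_[0,R]`, where the highest derivatives really occur. -/
structure IsInfinitesimallyFlatAt (f : StateSp n × InputSp → StateSp n)
    (φ : StateSp n → Fin 2 → ℝ) (R : Fin 2 → ℕ) (η : JetSp n N) : Prop where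
  state : ∀ v, (∀ j, ∀ k < R j, fderiv ℝ (outDeriv f N φ j k) η v = 0) → v.1 = 0
  input : ∃ c : Fin 2 → ℕ → InputSp, (∀ j, c j (R j) ≠ 0) ∧ ∀ v, jetU 0 v =
    ∑ j, ∑ k ∈ Finset.range (R j + 1), fderiv ℝ (outDeriv f N φ j k) η v • c j k

/-- Chain rule for x = F_x and u = F_u. From here on only this linear information is used. -/
theorem IsFlatAt.isInfinitesimallyFlatAt {V : Set (JetSp n N)} (hV : IsSmoothDomain f φ V)
    {η : JetSp n N} (hη : η ∈ V) (h : IsFlatAt f φ R η) : IsInfinitesimallyFlatAt f φ R η := by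
  obtain ⟨Yx, Yu, Fx, Fu, hYx, hYu, hFx, hFu, hev, htop⟩ := h
  have hd : ∀ j k, HasFDerivAt (outDeriv f N φ j k) (fderiv ℝ (outDeriv f N φ j k) η) η :=
    fun j k => ((hV.outDeriv j k).differentiableAt_of_isOpen hV.isOpen hη).hasFDerivAt
  obtain ⟨hx, hu, -, -⟩ := hev.self_of_nhds
  constructor
  · intro v hv
    have h1 : HasFDerivAt (fun ζ : JetSp n N => fun s : (Σ j : Fin 2, Fin (R j)) =>
        outDeriv f N φ s.1 s.2 ζ) _ η := hasFDerivAt_pi.2 fun s => hd s.1 s.2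
    have h2 := (hFx.differentiableAt_of_isOpen hYx hx).hasFDerivAt.comp η h1
    have h3 : HasFDerivAt (fun ζ : JetSp n N => ζ.1) _ η :=
      h2.congr_of_eventuallyEq (hev.mono fun ζ hζ => hζ.2.2.1)
    have h4 := congrArg (fun T => T v) ((hasFDerivAt_fst (𝕜 := ℝ) (p := η)).unique h3)
    have h5 : (ContinuousLinearMap.pi fun s : (Σ j : Fin 2, Fin (R j)) =>
        fderiv ℝ (outDeriv f N φ s.1 s.2) η) v = 0 := by
      ext s; exact hv s.1 s.2 s.2.2
    simp only [ContinuousLinearMap.comp_apply, h5, map_zero] at h4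
    exact h4
  · have h1 : HasFDerivAt (fun ζ : JetSp n N => fun s : (Σ j : Fin 2, Fin (R j + 1)) =>
        outDeriv f N φ s.1 s.2 ζ) _ η := hasFDerivAt_pi.2 fun s => hd s.1 s.2
    have h2 := (hFu.differentiableAt_of_isOpen hYu hu).hasFDerivAt.comp η h1
    have h3 : HasFDerivAt (fun ζ : JetSp n N => jetU 0 ζ) _ η :=
      h2.congr_of_eventuallyEq (hev.mono fun ζ hζ => (jetU_zero ζ).trans hζ.2.2.2)
    set y := (fun s : (Σ j : Fin 2, Fin (R j + 1)) => outDeriv f N φ s.1 s.2 η) with hy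
    refine ⟨fun j k => if hk : k < R j + 1 then fderiv ℝ Fu y (Pi.single ⟨j, k, hk⟩ 1) else 0,
      fun j => ?_, fun v => ?_⟩
    · dsimp only
      rw [dif_pos (Nat.lt_succ_self (R j))]
      exact htop j
    · have h4 := congrArg (fun T => T v) ((jetU 0 : JetSp n N →L[ℝ] InputSp).hasFDerivAt.unique h3)
      simp only at h4
      rw [h4, ContinuousLinearMap.comp_apply]
      have h5 := LinearMap.pi_apply_eq_sum_univ (fderiv ℝ Fu y).toLinearMap
        ((ContinuousLinearMap.pi fun s : (Σ j : Fin 2, Fin (R j + 1)) =>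
          fderiv ℝ (outDeriv f N φ s.1 s.2) η) v)
      rw [ContinuousLinearMap.coe_coe] at h5
      rw [h5, Fintype.sum_sigma]
      refine Finset.sum_congr rfl fun j _ => ?_
      rw [Finset.sum_range]
      refine Finset.sum_congr rfl fun k _ => ?_
      simp only [ContinuousLinearMap.coe_pi', k.2, dite_true]
      congr 2
      ext s
      simp [Pi.single_apply, eq_comm]

theorem IsInfinitesimallyFlatAt.input_top {η : JetSp n N}
    (h : IsInfinitesimallyFlatAt f φ R η) : ∃ c : Fin 2 → InputSp, (∀ j, c j ≠ 0) ∧ ∀ v : JetSp n N,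
      (∀ j, ∀ k < R j, fderiv ℝ (outDeriv f N φ j k) η v = 0) → jetU 0 v =
        fderiv ℝ (outDeriv f N φ 0 (R 0)) η v • c 0 +
        fderiv ℝ (outDeriv f N φ 1 (R 1)) η v • c 1 := by
  obtain ⟨c, hc, hcu⟩ := h.input
  refine ⟨fun j => c j (R j), hc, fun v hv => ?_⟩
  rw [hcu, Fin.sum_univ_two, Finset.sum_range_succ, Finset.sum_range_succ,
    Finset.sum_eq_zero, Finset.sum_eq_zero, zero_add, zero_add]
  · intro k hk; rw [hv 1 k (Finset.mem_range.1 hk), zero_smul]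
  · intro k hk; rw [hv 0 k (Finset.mem_range.1 hk), zero_smul]

theorem IsInfinitesimallyFlatAt.input_eq_zero {η : JetSp n N}
    (h : IsInfinitesimallyFlatAt f φ R η) {v : JetSp n N}
    (hv : ∀ j, ∀ k ≤ R j, fderiv ℝ (outDeriv f N φ j k) η v = 0) : jetU 0 v = 0 := by
  obtain ⟨c, -, hc⟩ := h.input_top
  rw [hc v fun j k hk => hv j k hk.le, hv 0 _ le_rfl, hv 1 _ le_rfl]
  simp

/-- The input space is two-dimensional. This excludes the cases in which u would be recovered from a
single top derivative. -/
theorem not_forall_eq_smul (ℓ : InputSp → ℝ) (c : InputSp) : ¬ ∀ t : InputSp, t = ℓ t • c := by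
  intro h
  have h0 := h (Pi.single 0 1)
  have h1 := h (Pi.single 1 1)
  have a0 := congrFun h0 0
  have a1 := congrFun h0 1
  have b1 := congrFun h1 1
  simp at a0 a1 b1
  rcases a1 with h | h <;> simp [h] at a0 b1

/-- The derivative of `φ^j_[κ]` with respect to the input. -/
noncomputable def inputDeriv (f : StateSp n × InputSp → StateSp n) (φ : StateSp n → Fin 2 → ℝ)
    (j : Fin 2) (κ : ℕ) (η : JetSp n N) : InputSp →ₗ[ℝ] ℝ where
  toFun t := fderiv ℝ (outDeriv f N φ j κ) η (jetSingle 0 t)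
  map_add' s t := by rw [jetSingle_add, map_add]
  map_smul' r t := by rw [jetSingle_smul, map_smul]; rfl

/-- A domain on which `φ` is flat, `φ^j` has relative degree `κ j = R j - e`, and the input `u^{c'}`
enters `φ¹_[κ 0]`. -/
structure IsRegularDomain (f : StateSp n × InputSp → StateSp n) (φ : StateSp n → Fin 2 → ℝ)
    (R κ : Fin 2 → ℕ) (e : ℕ) (c c' : Fin 2) (V : Set (JetSp n N)) : Prop where
  dom : IsSmoothDomain f φ V
  flat : ∀ η ∈ V, IsInfinitesimallyFlatAt f φ R η
  one_le : ∀ j, 1 ≤ κ j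
  order : ∀ j, R j = κ j + e
  le : ∀ j, R j ≤ N
  free : ∀ j, IsInputFree f φ j (κ j) V
  ne : c ≠ c'
  lead : ∀ η ∈ V, inputDeriv f φ 0 (κ 0) η (Pi.single c' 1) ≠ 0

theorem IsRegularDomain.mono {κ : Fin 2 → ℕ} {e : ℕ} {c c' : Fin 2} {V V' : Set (JetSp n N)}
    (h : IsRegularDomain f φ R κ e c c' V) (hV' : IsOpen V') (hsub : V' ⊆ V) :
    IsRegularDomain f φ R κ e c c' V' :=
  ⟨h.dom.mono hV' hsub, fun η hη => h.flat η (hsub hη), h.one_le, h.order, h.le,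
    fun j k hk => (h.free j k hk).mono_set hsub, h.ne, fun η hη => h.lead η (hsub hη)⟩

theorem exists_isRegularDomain {V : Set (JetSp n N)} (hV : IsSmoothDomain f φ V)
    (hne : V.Nonempty) (hflat : ∀ η ∈ V, IsInfinitesimallyFlatAt f φ R η) (hR : ∀ j, R j ≤ N) :
    ∃ V' ⊆ V, V'.Nonempty ∧ ∃ κ e c c', IsRegularDomain f φ R κ e c c' V' := by
  obtain ⟨V₁, hV₁V, hV₁, hne₁, κ₀, hκ₀, hκ₀R, hfree₀, hlead₀⟩ :=
    exists_relativeDegree hV hne 0 (R 0)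
  obtain ⟨V₂, hV₂V, hV₂, ⟨η, hη⟩, κ₁, hκ₁, hκ₁R, hfree₁, hlead₁⟩ :=
    exists_relativeDegree (hV.mono hV₁ hV₁V) hne₁ 1 (R 1)
  have hdom := hV.mono hV₂ (hV₂V.trans hV₁V)
  have hfree₀' : IsInputFree f φ 0 κ₀ V₂ := fun k hk => (hfree₀ k hk).mono_set hV₂V
  obtain ⟨c, hc, hcu⟩ := (hflat η (hV₁V (hV₂V hη))).input_top
  -- The parametrization of u tested along u_[M], where M bounds both differences R_j - κ_j: all
  -- derivatives of order below R_j are blind to this direction.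
  have key : ∀ M ≤ N, R 0 ≤ κ₀ + M → R 1 ≤ κ₁ + M → ∀ t : InputSp,
      (if (0 : ℕ) = M then t else 0) =
        fderiv ℝ (outDeriv f N φ 0 (R 0)) η (jetSingle M t) • c 0 +
        fderiv ℝ (outDeriv f N φ 1 (R 1)) η (jetSingle M t) • c 1 := by
    intro M hM h0 h1 t
    rw [← hcu, jetU_jetSingle hM]
    intro j k hk
    have hz : ∀ l < M, jetU l (jetSingle M t : JetSp n N) = 0 := fun l hl => by
      rw [jetU_jetSingle hM, if_neg hl.ne]
    fin_cases j
    · exact hfree₀'.hasOrd_of_lt hdom hκ₀ (show k < κ₀ + M from lt_of_lt_of_le hk h0) η hη _ rfl hz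
    · exact hfree₁.hasOrd_of_lt hdom hκ₁ (show k < κ₁ + M from lt_of_lt_of_le hk h1) η hη _ rfl hz
  have zero₀ : ∀ M ≤ N, R 0 < κ₀ + M → ∀ t,
      fderiv ℝ (outDeriv f N φ 0 (R 0)) η (jetSingle M t) = 0 := fun M hM h t =>
    hfree₀'.hasOrd_of_lt hdom hκ₀ h η hη _ rfl fun l hl => by
      rw [jetU_jetSingle hM, if_neg hl.ne]
  have zero₁ : ∀ M ≤ N, R 1 < κ₁ + M → ∀ t,
      fderiv ℝ (outDeriv f N φ 1 (R 1)) η (jetSingle M t) = 0 := fun M hM h t =>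
    hfree₁.hasOrd_of_lt hdom hκ₁ h η hη _ rfl fun l hl => by
      rw [jetU_jetSingle hM, if_neg hl.ne]
  have hR0 := hR 0
  have hR1 := hR 1
  have hRκ : ∃ e, R 0 = κ₀ + e ∧ R 1 = κ₁ + e := by
    -- Here u itself is recovered along the direction u_[0]; if one R_j were below κ_j, only the
    -- other top derivative would contribute.
    by_cases hM : R 0 ≤ κ₀ ∧ R 1 ≤ κ₁
    · refine ⟨0, ?_, ?_⟩
      · by_contra hlt
        refine not_forall_eq_smul
          (fun t => fderiv ℝ (outDeriv f N φ 1 (R 1)) η (jetSingle 0 t)) (c 1) fun t => ?_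
        have := key 0 (Nat.zero_le N) hM.1 hM.2 t
        rwa [if_pos rfl, zero₀ 0 (Nat.zero_le N) (by omega), zero_smul, zero_add] at this
      · by_contra hlt
        refine not_forall_eq_smul
          (fun t => fderiv ℝ (outDeriv f N φ 0 (R 0)) η (jetSingle 0 t)) (c 0) fun t => ?_
        have := key 0 (Nat.zero_le N) hM.1 hM.2 t
        rwa [if_pos rfl, zero₁ 0 (Nat.zero_le N) (by omega), zero_smul, add_zero] at this
    -- The output with the larger difference is alone in depending on u_[M], M ≥ 1. Its nonzero
    -- contribution to u would have to vanish.
    · rcases lt_trichotomy (R 0 - κ₀) (R 1 - κ₁) with hlt | heq | hgt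
      · exfalso
        rcases hlead₁ with h | ⟨i, hi⟩
        · omega
        have h1 := key (R 1 - κ₁) (by omega) (by omega) (by omega) (Pi.single i 1)
        have h2 := hfree₁.fderiv_outDeriv hdom hκ₁ (i := R 1 - κ₁) (by omega) hη
          (v := jetSingle (R 1 - κ₁) (Pi.single i 1)) rfl fun l hl => by
            rw [jetU_jetSingle (by omega), if_neg hl.ne]
        rw [jetU_jetSingle (by omega), if_pos rfl, show κ₁ + (R 1 - κ₁) = R 1 by omega] at h2
        rw [if_neg (by omega), zero₀ _ (by omega) (by omega), h2, zero_smul, zero_add] at h1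
        exact (smul_ne_zero (hi η hη) (hc 1)) h1.symm
      · exact ⟨R 0 - κ₀, by omega, by omega⟩
      · exfalso
        rcases hlead₀ with h | ⟨i, hi⟩
        · omega
        have h1 := key (R 0 - κ₀) (by omega) (by omega) (by omega) (Pi.single i 1)
        have h2 := hfree₀'.fderiv_outDeriv hdom hκ₀ (i := R 0 - κ₀) (by omega) hη
          (v := jetSingle (R 0 - κ₀) (Pi.single i 1)) rfl fun l hl => by
            rw [jetU_jetSingle (by omega), if_neg hl.ne]
        rw [jetU_jetSingle (by omega), if_pos rfl, show κ₀ + (R 0 - κ₀) = R 0 by omega] at h2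
        rw [if_neg (by omega), zero₁ _ (by omega) (by omega), h2, zero_smul, add_zero] at h1
        exact (smul_ne_zero (hi η (hV₂V hη)) (hc 0)) h1.symm
  obtain ⟨e, he0, he1⟩ := hRκ
  rcases hlead₀ with h | ⟨c', hc'⟩
  · omega
  -- In `Fin 2`, c' + 1 is the other input component.
  refine ⟨V₂, hV₂V.trans hV₁V, ⟨η, hη⟩, ![κ₀, κ₁], e, c' + 1, c', hdom,
    fun ζ hζ => hflat ζ (hV₁V (hV₂V hζ)), ?_, ?_, hR, ?_, ?_, fun ζ hζ => hc' ζ (hV₂V hζ)⟩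
  · intro j; fin_cases j <;> assumption
  · intro j; fin_cases j <;> assumption
  · intro j; fin_cases j <;> assumption
  · fin_cases c' <;> decide

end Flat

/-! ### The structure of flat outputs -/

section Structure

variable {n N : ℕ} {f : StateSp n × InputSp → StateSp n} {φ : StateSp n → Fin 2 → ℝ}
  {R κ : Fin 2 → ℕ} {e : ℕ} {c c' : Fin 2} {V : Set (JetSp n N)}

/-- The scalar coordinate `u^c_[l]`. -/
noncomputable def inputJet (c : Fin 2) (l : ℕ) (η : JetSp n N) : ℝ := jetU l η c

theorem hasFDerivAt_inputJet (c : Fin 2) (l : ℕ) (η : JetSp n N) :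
    HasFDerivAt (inputJet c l) ((ContinuousLinearMap.proj c).comp (jetU l : JetSp n N →L[ℝ] _)) η :=
  ((ContinuousLinearMap.proj (R := ℝ) (φ := fun _ : Fin 2 => ℝ) c).comp
    (jetU l : JetSp n N →L[ℝ] _)).hasFDerivAt

theorem fderiv_inputJet (c : Fin 2) (l : ℕ) (η v : JetSp n N) :
    fderiv ℝ (inputJet c l) η v = jetU l v c := by
  rw [(hasFDerivAt_inputJet c l η).fderiv]; rfl

theorem contDiff_inputJet (c : Fin 2) (l : ℕ) :
    ContDiff ℝ ∞ (inputJet c l : JetSp n N → ℝ) :=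
  ((ContinuousLinearMap.proj (R := ℝ) (φ := fun _ : Fin 2 => ℝ) c).comp
    (jetU l : JetSp n N →L[ℝ] _)).contDiff

theorem lieD_inputJet (c : Fin 2) (l : ℕ) :
    lieD (totalField f N) (inputJet c l : JetSp n N → ℝ) = inputJet c (l + 1) := by
  funext η
  rw [lieD, fderiv_inputJet, jetU_totalField]; rfl

theorem hasOrd_inputJet (c : Fin 2) (l : ℕ) : HasOrd (inputJet c l) (l + 1) V := by
  intro η _ v _ hl
  rw [fderiv_inputJet, hl l (Nat.lt_succ_self l)]; rfl

/-! ### Coordinates adapted to the first output -/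

/-- The functions `x, φ¹_[κ], …, φ¹_[κ+a-1], u^c, …, u^c_[b-1]`. -/
noncomputable def adapted (f : StateSp n × InputSp → StateSp n) (φ : StateSp n → Fin 2 → ℝ)
    (κ : Fin 2 → ℕ) (c : Fin 2) (a b : ℕ) : Fin n ⊕ (Fin a ⊕ Fin b) → JetSp n N → ℝ :=
  Sum.elim (fun i η => η.1 i)
    (Sum.elim (fun l => outDeriv f N φ 0 (κ 0 + l)) fun l => inputJet c l)

/-- The common kernel of the differentials of `adapted f φ κ c a b`. -/
structure InKer (f : StateSp n × InputSp → StateSp n) (φ : StateSp n → Fin 2 → ℝ)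
    (κ : Fin 2 → ℕ) (c : Fin 2) (a b : ℕ) (η v : JetSp n N) : Prop where
  state : v.1 = 0
  out : ∀ l < a, fderiv ℝ (outDeriv f N φ 0 (κ 0 + l)) η v = 0
  input : ∀ l < b, jetU l v c = 0

theorem InKer.mono {a b a' b' : ℕ} {η v : JetSp n N} (h : InKer f φ κ c a b η v) (ha : a' ≤ a)
    (hb : b' ≤ b) : InKer f φ κ c a' b' η v :=
  ⟨h.state, fun l hl => h.out l (hl.trans_le ha), fun l hl => h.input l (hl.trans_le hb)⟩

theorem fderiv_fst_apply (i : Fin n) (η v : JetSp n N) :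
    fderiv ℝ (fun ζ : JetSp n N => ζ.1 i) η v = v.1 i := by
  have h : HasFDerivAt (fun ζ : JetSp n N => ζ.1 i) _ η :=
    ((ContinuousLinearMap.proj (R := ℝ) (φ := fun _ : Fin n => ℝ) i).comp
      (ContinuousLinearMap.fst ℝ (StateSp n) (Fin (N + 1) → InputSp))).hasFDerivAt
  rw [h.fderiv]
  rfl

theorem inKer_iff {a b : ℕ} {η v : JetSp n N} : InKer f φ κ c a b η v ↔
    ∀ i, fderiv ℝ (adapted f φ κ c a b i) η v = 0 := by
  simp only [Sum.forall, adapted, Sum.elim_inl, Sum.elim_inr, fderiv_fst_apply, fderiv_inputJet]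
  refine ⟨fun h => ⟨fun i => by rw [h.state]; rfl, fun l => h.out l l.2, fun l => h.input l l.2⟩,
    fun h => ⟨funext h.1, fun l hl => h.2.1 ⟨l, hl⟩, fun l hl => h.2.2 ⟨l, hl⟩⟩⟩

namespace IsRegularDomain

theorem fderiv_lead (h : IsRegularDomain f φ R κ e c c' V) (j : Fin 2) {i : ℕ} (hi : i ≤ N)
    {η : JetSp n N} (hη : η ∈ V) {v : JetSp n N} (hv : v.1 = 0) (hl : ∀ l < i, jetU l v = 0) :
    fderiv ℝ (outDeriv f N φ j (κ j + i)) η v = inputDeriv f φ j (κ j) η (jetU i v) :=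
  (h.free j).fderiv_outDeriv h.dom (h.one_le j) hi hη hv hl

theorem eq_smul_single (h : IsRegularDomain f φ R κ e c c' V) {t : InputSp} (ht : t c = 0) :
    t = t c' • (Pi.single c' 1 : InputSp) := by
  have := h.ne
  ext i
  fin_cases c <;> fin_cases c' <;> fin_cases i <;> simp_all

/-- The covectors ∂φ¹_[κ₁]/∂u and du^c form a basis, since u^{c'} enters φ¹_[κ₁]. -/
theorem input_eq_zero (h : IsRegularDomain f φ R κ e c c' V) {η : JetSp n N} (hη : η ∈ V)
    {t : InputSp} (ht : inputDeriv f φ 0 (κ 0) η t = 0) (htc : t c = 0) : t = 0 := by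
  rw [h.eq_smul_single htc, map_smul, smul_eq_mul] at ht
  rw [h.eq_smul_single htc, (mul_eq_zero.1 ht).resolve_right (h.lead η hη), zero_smul]

/-- Order by order: once the lower u-components vanish, dφ¹_[κ₁+l] reduces to its leading term in
u_[l]. -/
theorem jetU_eq_zero (h : IsRegularDomain f φ R κ e c c' V) {η : JetSp n N} (hη : η ∈ V)
    {v : JetSp n N} {a b : ℕ} (hb : b ≤ a) (hbN : b ≤ N + 1) (hv : InKer f φ κ c a b η v) :
    ∀ l < b, jetU l v = 0 := by
  intro l
  induction l using Nat.strong_induction_on with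
  | _ l ih =>
    intro hl
    refine h.input_eq_zero hη ?_ (hv.input l hl)
    rw [← h.fderiv_lead 0 (by omega) hη hv.state fun m hm => ih m hm (hm.trans hl)]
    exact hv.out l (by omega)

/-- The system is triangular: a change in u_[m] leaves dφ¹_[κ₁+l] for l < m untouched, and each step
is a 2 × 2 system solved through the nonzero derivative with respect to u^{c'}. -/
theorem exists_prescribed (h : IsRegularDomain f φ R κ e c c' V) {η : JetSp n N} (hη : η ∈ V)
    (x : StateSp n) (y t : ℕ → ℝ) (m : ℕ) (hm : m ≤ N + 1) : ∃ v : JetSp n N, v.1 = x ∧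
      ∀ l < m, fderiv ℝ (outDeriv f N φ 0 (κ 0 + l)) η v = y l ∧ jetU l v c = t l := by
  induction m with
  | zero => exact ⟨(x, 0), rfl, fun l hl => absurd hl (Nat.not_lt_zero l)⟩
  | succ m ih =>
    obtain ⟨v, hvx, hv⟩ := ih (by omega)
    obtain ⟨s, hs, hsc⟩ : ∃ s : InputSp, inputDeriv f φ 0 (κ 0) η s =
        y m - fderiv ℝ (outDeriv f N φ 0 (κ 0 + m)) η v ∧ s c = t m - jetU m v c := by
      set A := inputDeriv f φ 0 (κ 0) η
      set p := y m - fderiv ℝ (outDeriv f N φ 0 (κ 0 + m)) η v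
      set q := t m - jetU m v c
      refine ⟨q • Pi.single c 1 + ((p - q * A (Pi.single c 1)) / A (Pi.single c' 1)) •
        Pi.single c' 1, ?_, ?_⟩
      · rw [map_add, map_smul, map_smul, smul_eq_mul, smul_eq_mul,
          div_mul_cancel₀ _ (h.lead η hη)]
        ring
      · simp [h.ne]
    have hz : ∀ l < m, jetU l (jetSingle m s : JetSp n N) = 0 := fun l hl => by
      rw [jetU_jetSingle (by omega), if_neg hl.ne]
    refine ⟨v + jetSingle m s, by simp [hvx], fun l hl => ?_⟩
    rcases Nat.lt_succ_iff_lt_or_eq.1 hl with hlm | rfl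
    · rw [map_add, map_add, hz l hlm, h.fderiv_lead 0 (by omega) hη (v := jetSingle m s) rfl
        fun l' hl' => hz l' (hl'.trans hlm), hz l hlm, map_zero, add_zero, add_zero]
      exact hv l hlm
    · rw [map_add, map_add, h.fderiv_lead 0 (by omega) hη (v := jetSingle l s) rfl hz,
        jetU_jetSingle (by omega), if_pos rfl, hs]
      simp [hsc]

theorem indepAt_adapted (h : IsRegularDomain f φ R κ e c c' V) {η : JetSp n N} (hη : η ∈ V)
    {a b : ℕ} (hb : b ≤ a) (ha : a ≤ N + 1) : IndepAt (adapted f φ κ c a b) η := by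
  intro y
  obtain ⟨v, hvx, hv⟩ := h.exists_prescribed hη (fun i => y (Sum.inl i))
    (fun l => if hl : l < a then y (Sum.inr (Sum.inl ⟨l, hl⟩)) else 0)
    (fun l => if hl : l < b then y (Sum.inr (Sum.inr ⟨l, hl⟩)) else 0) a ha
  refine ⟨v, ?_⟩
  simp only [Sum.forall, adapted, Sum.elim_inl, Sum.elim_inr, fderiv_fst_apply, fderiv_inputJet]
  refine ⟨fun i => by rw [hvx], fun l => ?_, fun l => ?_⟩
  · simpa using (hv l l.2).1
  · simpa using (hv l (by omega)).2

theorem exists_inKer (h : IsRegularDomain f φ R κ e c c' V) {η : JetSp n N} (hη : η ∈ V)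
    {a b : ℕ} (hb : b < a) (ha : a ≤ N + 1) :
    ∃ v, InKer f φ κ c a b η v ∧ jetU b v c = 1 := by
  obtain ⟨v, hvx, hv⟩ := h.exists_prescribed hη 0 0 (fun l => if l = b then 1 else 0) a ha
  exact ⟨v, ⟨hvx, fun l hl => (hv l hl).1, fun l hl => by rw [(hv l (by omega)).2, if_neg hl.ne]⟩,
    by rw [(hv b hb).2, if_pos rfl]⟩

theorem contDiffOn_adapted (h : IsRegularDomain f φ R κ e c c' V) {a b : ℕ}
    (i : Fin n ⊕ (Fin a ⊕ Fin b)) : ContDiffOn ℝ ∞ (adapted f φ κ c a b i) V := by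
  rcases i with i | l | l
  · exact ContDiff.contDiffOn (f := fun η : JetSp n N => η.1 i) (by fun_prop)
  · exact h.dom.outDeriv 0 _
  · exact (contDiff_inputJet c l).contDiffOn

/-- A function whose differential is a combination of those of an adapted family, and its Lie
derivative. -/
theorem exists_coeff_lieD (h : IsRegularDomain f φ R κ e c c' V) {g : JetSp n N → ℝ}
    (hg : ContDiffOn ℝ ∞ g V) {a b : ℕ} (hb : b ≤ a) (ha : a ≤ N + 1)
    (hker : ∀ η ∈ V, ∀ v, InKer f φ κ c a b η v → fderiv ℝ g η v = 0) {ξ : JetSp n N}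
    (hξ : ξ ∈ V) : ∃ U ⊆ V, IsOpen U ∧ ξ ∈ U ∧ ∃ y : Fin b → JetSp n N → ℝ,
      (∀ l, ContinuousOn (y l) U) ∧ ∀ η ∈ U, ∀ v,
        (InKer f φ κ c a 0 η v → fderiv ℝ g η v = ∑ l, y l η * jetU l v c) ∧
        (InKer f φ κ c (a + 1) b η v → jetU 0 v = 0 →
          fderiv ℝ (lieD (totalField f N) g) η v = ∑ l, y l η * jetU (l + 1) v c) := by
  obtain ⟨U, hUV, hU, hξU, y, hy, hrel⟩ := (h.indepAt_adapted hξ hb ha).exists_coeff h.dom.isOpen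
    h.contDiffOn_adapted hg hξ fun η hη v hv => hker η hη v (inKer_iff.2 hv)
  refine ⟨U, hUV, hU, hξU, fun l => y (Sum.inr (Sum.inr l)), fun l => (hy _).continuousOn,
    fun η hη v => ⟨fun hv => ?_, fun hv hv0 => ?_⟩⟩
  · rw [hrel η hη v, Fintype.sum_sum_type, Fintype.sum_sum_type, Finset.sum_eq_zero,
      Finset.sum_eq_zero, zero_add, zero_add]
    · exact Finset.sum_congr rfl fun l _ => by
        rw [show adapted f φ κ c a b (Sum.inr (Sum.inr l)) = inputJet c l from rfl,
          fderiv_inputJet]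
    · intro l _
      rw [show adapted f φ κ c a b (Sum.inr (Sum.inl l)) = outDeriv f N φ 0 (κ 0 + l) from rfl,
        hv.out l l.2, mul_zero]
    · intro i _
      rw [show adapted f φ κ c a b (Sum.inl i) = fun ζ : JetSp n N => ζ.1 i from rfl,
        fderiv_fst_apply, hv.state]
      simp
  · have hvker := inKer_iff.1 (hv.mono (Nat.le_succ a) le_rfl)
    have hU' := h.mono hU hUV
    rw [fderiv_lieD_of_relation hU hU'.dom.totalField (hg.mono hUV) hU'.contDiffOn_adapted hy hrel
      hη v]
    simp only [hvker, mul_zero, zero_add]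
    rw [Fintype.sum_sum_type, Fintype.sum_sum_type, Finset.sum_eq_zero, Finset.sum_eq_zero,
      zero_add, zero_add]
    · exact Finset.sum_congr rfl fun l _ => by
        rw [show adapted f φ κ c a b (Sum.inr (Sum.inr l)) = inputJet c l from rfl,
          lieD_inputJet, fderiv_inputJet]
    · intro l _
      rw [show adapted f φ κ c a b (Sum.inr (Sum.inl l)) = outDeriv f N φ 0 (κ 0 + l) from rfl,
        ← outDeriv_succ, add_assoc, hv.out _ (by omega), mul_zero]
    -- The Lie derivative of x is f(x, u), whose differential sees only the x- and u-components of
    -- v, both zero.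
    · intro i _
      have hlie : lieD (totalField f N) (adapted f φ κ c a b (Sum.inl i)) =
          fun ζ : JetSp n N => f (ζ.1, ζ.2 0) i := by
        funext ζ
        exact fderiv_fst_apply i ζ _
      have hd := h.dom.totalField.differentiableAt_of_isOpen h.dom.isOpen (hUV hη)
      have h1 : HasFDerivAt (fun ζ : JetSp n N => (totalField f N ζ).1 i)
        (((ContinuousLinearMap.proj (R := ℝ) (φ := fun _ : Fin n => ℝ) i).comp
          (ContinuousLinearMap.fst ℝ (StateSp n) (Fin (N + 1) → InputSp))).comp
            (fderiv ℝ (totalField f N) η)) η :=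
        ((ContinuousLinearMap.proj (R := ℝ) (φ := fun _ : Fin n => ℝ) i).comp
          (ContinuousLinearMap.fst ℝ (StateSp n) (Fin (N + 1) → InputSp))).hasFDerivAt.comp η
            hd.hasFDerivAt
      rw [hlie, show (fun ζ : JetSp n N => f (ζ.1, ζ.2 0) i) =
        fun ζ => (totalField f N ζ).1 i from rfl, h1.fderiv]
      simp only [ContinuousLinearMap.comp_apply, ContinuousLinearMap.coe_fst',
        ContinuousLinearMap.proj_apply]
      rw [h.dom.fderiv_totalField_fst (hUV hη), hv.state, hv0,
        show ((0 : StateSp n), (0 : InputSp)) = 0 from rfl, map_zero]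
      simp

end IsRegularDomain

/-- Modulo the differentials of `x, φ¹_[≤κ+m+i], u^c, …, u^c_[i-1]`, the differential of
`φ²_[κ+m+i]` is a nonzero multiple of that of `u^c_[i]`. -/
def IsLeadingAt (f : StateSp n × InputSp → StateSp n) (φ : StateSp n → Fin 2 → ℝ)
    (κ : Fin 2 → ℕ) (c : Fin 2) (m i : ℕ) (η : JetSp n N) : Prop :=
  ∃ γ : ℝ, γ ≠ 0 ∧ ∀ v, InKer f φ κ c (m + 1 + i) i η v →
    fderiv ℝ (outDeriv f N φ 1 (κ 1 + m + i)) η v = γ * jetU i v c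

namespace IsRegularDomain

/-- Lie differentiation turns u^c_[i] into u^c_[i+1] and keeps its coefficient; the terms with
differentiated coefficients involve only differentials already in the adapted family. -/
theorem isLeadingAt_succ (h : IsRegularDomain f φ R κ e c c' V) {m i : ℕ} (hmi : m + i ≤ N)
    (hlead : ∀ η ∈ V, IsLeadingAt f φ κ c m i η) {η : JetSp n N} (hη : η ∈ V) :
    IsLeadingAt f φ κ c m (i + 1) η := by
  obtain ⟨U, -, -, hηU, y, -, hy⟩ := h.exists_coeff_lieD (h.dom.outDeriv 1 (κ 1 + m + i))
    (a := m + 1 + i) (b := i + 1) (by omega) (by omega) (fun ζ hζ v hv => by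
      obtain ⟨γ, -, hγ⟩ := hlead ζ hζ
      rw [hγ v (hv.mono le_rfl (Nat.le_succ i)), hv.input i (Nat.lt_succ_self i), mul_zero]) hη
  obtain ⟨γ, hγ0, hγ⟩ := hlead η hη
  have hsum : ∀ (t : ℕ → ℝ), (∀ l < i, t l = 0) →
      ∑ l : Fin (i + 1), y l η * t l = y (Fin.last i) η * t i := fun t ht => by
    rw [Fin.sum_univ_castSucc, Finset.sum_eq_zero, zero_add]
    · rfl
    · intro l _
      rw [Fin.val_castSucc, ht l l.2, mul_zero]
  refine ⟨y (Fin.last i) η, ?_, fun v hv => ?_⟩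
  -- The coefficient is γ: both expressions are evaluated on an adapted vector with
  -- u^c_[i]-component 1.
  · obtain ⟨v, hv, hv1⟩ := h.exists_inKer hη (a := m + 1 + i) (b := i) (by omega) (by omega)
    have h1 := (hy η hηU v).1 (hv.mono le_rfl (Nat.zero_le i))
    rw [hγ v hv, hsum (fun l => jetU l v c) fun l hl => hv.input l hl, hv1] at h1
    simp only [mul_one] at h1
    rwa [← h1]
  · have h0 := h.jetU_eq_zero hη (b := i + 1) (by omega) (by omega) hv 0 (Nat.succ_pos i)
    have h1 := (hy η hηU v).2 hv h0
    rw [hsum (fun l => jetU (l + 1) v c) fun l hl => hv.input (l + 1) (by omega)] at h1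
    rw [← add_assoc, outDeriv_succ, h1]

theorem isLeadingAt_of_zero (h : IsRegularDomain f φ R κ e c c' V) {m i : ℕ}
    (hmi : m + i ≤ N + 1) (hlead : ∀ η ∈ V, IsLeadingAt f φ κ c m 0 η) :
    ∀ η ∈ V, IsLeadingAt f φ κ c m i η := by
  induction i with
  | zero => exact hlead
  | succ i ih => exact fun η hη => h.isLeadingAt_succ (by omega) (ih (by omega)) hη

/-- Since κ_j ≥ 1, the truncated jet space has room for the inputs up to order e + 1. -/
theorem add_one_le (h : IsRegularDomain f φ R κ e c c' V) : e + 1 ≤ N := by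
  have := h.one_le 0; have := h.order 0; have := h.le 0; omega

theorem fderiv_out_zero (h : IsRegularDomain f φ R κ e c c' V) {η : JetSp n N} (hη : η ∈ V)
    {a b : ℕ} {v : JetSp n N} (hv : InKer f φ κ c a b η v) {k : ℕ} (hk : k < κ 0 + a) :
    fderiv ℝ (outDeriv f N φ 0 k) η v = 0 := by
  by_cases hlt : k < κ 0
  · exact h.free 0 k hlt η hη v hv.state (by simp)
  · obtain ⟨l, rfl⟩ := Nat.exists_eq_add_of_le (Nat.not_lt.1 hlt)
    exact hv.out l (by omega)

/-- If `e ≥ 1`, the differential of `φ²_[κ]` with respect to the input is a nonzero multiple of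
that of `φ¹_[κ]`. -/
theorem exists_ratio (h : IsRegularDomain f φ R κ e c c' V) (he : 1 ≤ e) {η : JetSp n N}
    (hη : η ∈ V) : ∃ r : ℝ, r ≠ 0 ∧ ∀ t,
      inputDeriv f φ 1 (κ 1) η t = r * inputDeriv f φ 0 (κ 0) η t := by
  obtain ⟨d, hd, hdu⟩ := (h.flat η hη).input_top
  have heN := h.add_one_le
  have hz : ∀ t, ∀ l < e, jetU l (jetSingle e t : JetSp n N) = 0 := fun t l hl => by
    rw [jetU_jetSingle (by omega), if_neg hl.ne]
  -- The direction u_[e] does not move u, because e ≥ 1.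
  have key : ∀ t, inputDeriv f φ 0 (κ 0) η t • d 0 + inputDeriv f φ 1 (κ 1) η t • d 1 = 0 := by
    intro t
    have h1 := hdu (jetSingle e t) fun j k hk => (h.free j).hasOrd_of_lt h.dom (h.one_le j)
      (show k < κ j + e by rwa [← h.order j]) η hη _ rfl (hz t)
    rw [h.order 0, h.order 1, h.fderiv_lead 0 (by omega) hη rfl (hz t),
      h.fderiv_lead 1 (by omega) hη rfl (hz t), jetU_jetSingle (by omega), if_neg (by omega),
      jetU_jetSingle (by omega), if_pos rfl] at h1
    exact h1.symm
  set A := inputDeriv f φ 0 (κ 0) η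
  set B := inputDeriv f φ 1 (κ 1) η
  set t₀ : InputSp := Pi.single c' 1
  have hA : A t₀ ≠ 0 := h.lead η hη
  have hB : B t₀ ≠ 0 := fun hB => by
    have := key t₀
    rw [hB, zero_smul, add_zero] at this
    exact smul_ne_zero hA (hd 0) this
  refine ⟨B t₀ / A t₀, div_ne_zero hB hA, fun t => ?_⟩
  have h1 := key (t - (A t / A t₀) • t₀)
  have h2 : A (t - (A t / A t₀) • t₀) = 0 := by
    rw [map_sub, map_smul, smul_eq_mul, div_mul_cancel₀ _ hA, sub_self]
  rw [h2, zero_smul, zero_add] at h1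
  have h3 := (smul_eq_zero.1 h1).resolve_right (hd 1)
  rw [map_sub, map_smul, smul_eq_mul, sub_eq_zero] at h3
  rw [h3]; ring

/-- If φ²_[κ₂+s-1] involves only x and derivatives of φ¹, one more derivative brings in u through f,
and modulo φ¹_[κ₁] this is at most u^c. -/
theorem fderiv_out_one_of_forall (h : IsRegularDomain f φ R κ e c c' V) {s : ℕ} (hs : s ≤ e)
    (hP : ∀ s' < s, ∀ η ∈ V, ∀ v, InKer f φ κ c (s' + 1) 0 η v →
      fderiv ℝ (outDeriv f N φ 1 (κ 1 + s')) η v = 0) {η : JetSp n N} (hη : η ∈ V)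
    {v : JetSp n N} (hv : InKer f φ κ c (s + 1) 1 η v) :
    fderiv ℝ (outDeriv f N φ 1 (κ 1 + s)) η v = 0 := by
  have heN := h.add_one_le
  have h0 := h.jetU_eq_zero hη (by omega) (by omega) hv 0 Nat.one_pos
  rcases Nat.eq_zero_or_pos s with rfl | hpos
  · rw [h.fderiv_lead 1 (Nat.zero_le N) hη hv.state (by simp), h0, map_zero]
  · obtain ⟨s, rfl⟩ : ∃ s', s = s' + 1 := ⟨s - 1, by omega⟩
    obtain ⟨U, -, -, hηU, y, -, hy⟩ := h.exists_coeff_lieD (h.dom.outDeriv 1 (κ 1 + s))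
      (a := s + 1) (b := 0) (by omega) (by omega) (hP s (Nat.lt_succ_self s)) hη
    rw [← add_assoc, outDeriv_succ, (hy η hηU v).2 (hv.mono le_rfl (Nat.zero_le 1)) h0]
    simp

/-- The differentials of `φ²_[κ], …, φ²_[κ+e-1]` are combinations of those of
`x, φ¹_[κ], …, φ¹_[κ+e-1]`. -/
theorem fderiv_out_one (h : IsRegularDomain f φ R κ e c c' V) {s : ℕ} (hs : s < e) :
    ∀ η ∈ V, ∀ v, InKer f φ κ c (s + 1) 0 η v →
      fderiv ℝ (outDeriv f N φ 1 (κ 1 + s)) η v = 0 := by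
  induction s using Nat.strong_induction_on with
  | _ s ih =>
    by_contra! hcon
    obtain ⟨η, hη, v, hv, hvne⟩ := hcon
    have heN := h.add_one_le
    have hG : ∀ ζ ∈ V, ∀ w, InKer f φ κ c (s + 1) 1 ζ w →
        fderiv ℝ (outDeriv f N φ 1 (κ 1 + s)) ζ w = 0 := fun ζ hζ w hw =>
      h.fderiv_out_one_of_forall hs.le (fun s' hs' => ih s' hs' (by omega)) hζ hw
    obtain ⟨U, hUV, hU, hηU, y, hyc, hy⟩ := h.exists_coeff_lieD (h.dom.outDeriv 1 (κ 1 + s))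
      (a := s + 1) (b := 1) (by omega) (by omega) hG hη
    have hyη : y 0 η ≠ 0 := fun h0 => hvne (by
      rw [(hy η hηU v).1 hv]; simp [h0])
    -- The leading-term recursion needs an open set, so the domain is shrunk to where the
    -- coefficient of u^c does not vanish.
    have hU'o : IsOpen (U ∩ y 0 ⁻¹' {0}ᶜ) :=
      (hyc 0).isOpen_inter_preimage hU isOpen_compl_singleton
    have h' := h.mono hU'o (inter_subset_left.trans hUV)
    have hlead : ∀ i, s + i ≤ N + 1 → IsLeadingAt f φ κ c s i η := fun i hi =>
      h'.isLeadingAt_of_zero hi (fun ζ hζ => ⟨y 0 ζ, hζ.2, fun w hw => by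
        have := (hy ζ hζ.1 w).1 hw
        simpa using this⟩) η ⟨hηU, hyη⟩
    -- A direction fixing x, φ¹_[≤r₁] and u^c_[l] for l < e - s, while moving u^c_[e-s]. It moves
    -- φ²_[r₂] but no lower output derivative and not u, although ∂F_u/∂φ²_[r₂] ≠ 0.
    obtain ⟨w, hw, hw1⟩ := h.exists_inKer hη (a := e + 1) (b := e - s) (by omega) (by omega)
    have hw0 := h.jetU_eq_zero hη (by omega) (by omega) hw 0 (by omega)
    obtain ⟨d, hd, hdu⟩ := (h.flat η hη).input_top
    have h0 : ∀ k ≤ R 0, fderiv ℝ (outDeriv f N φ 0 k) η w = 0 := fun k hk =>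
      h.fderiv_out_zero hη hw (by rw [h.order 0] at hk; omega)
    have h1 : ∀ k < R 1, fderiv ℝ (outDeriv f N φ 1 k) η w = 0 := by
      intro k hk
      rw [h.order 1] at hk
      by_cases hlt : k < κ 1
      · exact h.free 1 k hlt η hη w hw.state (by simp)
      obtain ⟨l, rfl⟩ := Nat.exists_eq_add_of_le (Nat.not_lt.1 hlt)
      by_cases hls : l < s
      · exact ih l hls (by omega) η hη w (hw.mono (by omega) (Nat.zero_le _))
      obtain ⟨i, rfl⟩ := Nat.exists_eq_add_of_le (Nat.not_lt.1 hls)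
      obtain ⟨γ, -, hγ⟩ := hlead i (by omega)
      rw [← add_assoc, hγ w (hw.mono (by omega) (by omega)), hw.input i (by omega), mul_zero]
    have h2 := hdu w (by
      intro j k hk
      fin_cases j
      · exact h0 k hk.le
      · exact h1 k hk)
    obtain ⟨γ, hγ0, hγ⟩ := hlead (e - s) (by omega)
    have h3 := hγ w (hw.mono (by omega) le_rfl)
    rw [show κ 1 + s + (e - s) = R 1 by rw [h.order 1]; omega, hw1, mul_one] at h3
    rw [hw0, h0 _ le_rfl, h3, zero_smul, zero_add] at h2
    exact smul_ne_zero hγ0 (hd 1) h2.symm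

theorem fderiv_out_one_of_lt (h : IsRegularDomain f φ R κ e c c' V) {η : JetSp n N} (hη : η ∈ V)
    {b : ℕ} {v : JetSp n N} (hv : InKer f φ κ c e b η v) {k : ℕ} (hk : k < R 1) :
    fderiv ℝ (outDeriv f N φ 1 k) η v = 0 := by
  rw [h.order 1] at hk
  by_cases hlt : k < κ 1
  · exact h.free 1 k hlt η hη v hv.state (by simp)
  · obtain ⟨l, rfl⟩ := Nat.exists_eq_add_of_le (Nat.not_lt.1 hlt)
    exact h.fderiv_out_one (by omega) η hη v (hv.mono (by omega) (Nat.zero_le _))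

/-- If u^c did not enter φ²_[r₂], a direction fixing x and φ¹_[≤r₁] and moving u^c would fix all of
φ_[0,R], hence u. -/
theorem isLeadingAt (h : IsRegularDomain f φ R κ e c c' V) (he : 1 ≤ e) {i : ℕ}
    (hi : e + i ≤ N + 1) : ∀ η ∈ V, IsLeadingAt f φ κ c e i η := by
  refine h.isLeadingAt_of_zero hi fun η hη => ?_
  have heN := h.add_one_le
  obtain ⟨U, hUV, hU, hηU, y, hyc, hy⟩ := h.exists_coeff_lieD (h.dom.outDeriv 1 (κ 1 + e))
    (a := e + 1) (b := 1) (by omega) (by omega) (fun ζ hζ w hw =>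
      h.fderiv_out_one_of_forall le_rfl (fun s' hs' => h.fderiv_out_one hs') hζ hw) hη
  have hyv : ∀ v, InKer f φ κ c (e + 1) 0 η v →
      fderiv ℝ (outDeriv f N φ 1 (κ 1 + e)) η v = y 0 η * jetU 0 v c := fun v hv => by
    simpa using (hy η hηU v).1 hv
  refine ⟨y 0 η, fun hy0 => ?_, hyv⟩
  obtain ⟨v, hv, hv1⟩ := h.exists_inKer hη (a := e + 1) (b := 0) (by omega) (by omega)
  have : jetU 0 v = 0 := (h.flat η hη).input_eq_zero fun j k hk => by
    fin_cases j
    · exact h.fderiv_out_zero hη hv (by rw [← add_assoc, ← h.order 0]; exact Nat.lt_succ_of_le hk)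
    · rcases Nat.lt_or_eq_of_le hk with hlt | heq
      · exact h.fderiv_out_one_of_lt hη (hv.mono (Nat.le_succ e) le_rfl) hlt
      · subst heq
        have := hyv v hv
        rwa [hy0, zero_mul, ← h.order 1] at this
  rw [this] at hv1
  simp at hv1

end IsRegularDomain

end Structure

/-! ### Independence of the output derivatives and the differential difference -/

section Independence

variable {n N : ℕ} {f : StateSp n × InputSp → StateSp n} {φ : StateSp n → Fin 2 → ℝ}
  {R κ : Fin 2 → ℕ} {e : ℕ} {c c' : Fin 2} {V : Set (JetSp n N)}

/-- On `U` the differentials of the `φ^j_[k]`, `k ≤ R j - s`, satisfy a smooth linear relation in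
which the differential of some `φ^j_[R j - s]` has a nonvanishing coefficient. -/
def HasRelation (f : StateSp n × InputSp → StateSp n) (φ : StateSp n → Fin 2 → ℝ)
    (R : Fin 2 → ℕ) (s : ℕ) (U : Set (JetSp n N)) : Prop :=
  ∃ y : Fin 2 → ℕ → JetSp n N → ℝ, (∀ j k, ContDiffOn ℝ ∞ (y j k) U) ∧
    (∀ j k, R j < k + s → ∀ η ∈ U, y j k η = 0) ∧
    (∃ j k, k + s = R j ∧ ∀ η ∈ U, y j k η ≠ 0) ∧
    ∀ η ∈ U, ∀ v, ∑ j, ∑ k ∈ Finset.range (R j + 1),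
      y j k η * fderiv ℝ (outDeriv f N φ j k) η v = 0

/-- The leading coefficient reappears unchanged, one derivative higher. -/
theorem HasRelation.lieD {U : Set (JetSp n N)} (hU : IsSmoothDomain f φ U) {s : ℕ}
    (h : HasRelation f φ R (s + 1) U) : HasRelation f φ R s U := by
  obtain ⟨y, hy, hvan, ⟨j₀, k₀, hk₀, htop⟩, hrel⟩ := h
  set τ := totalField f N
  have hlie0 : ∀ j k, R j < k + (s + 1) → ∀ η ∈ U, _root_.lieD τ (y j k) η = 0 := by
    intro j k hk η hη
    have : y j k =ᶠ[𝓝 η] fun _ => 0 := by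
      filter_upwards [hU.isOpen.mem_nhds hη] with ζ hζ using hvan j k hk ζ hζ
    rw [_root_.lieD, this.fderiv_eq]
    simp
  -- Product rule: the differential of φ^j_[k] collects the Lie derivative of its own coefficient
  -- and the coefficient of φ^j_[k-1], taken as 0 for k = 0.
  refine ⟨fun j k η => _root_.lieD τ (y j k) η + (if k = 0 then 0 else y j (k - 1) η), ?_, ?_,
    ⟨j₀, k₀ + 1, by omega, fun η hη => ?_⟩, fun η hη v => ?_⟩
  · intro j k
    refine (contDiffOn_lieD hU.isOpen hU.totalField (hy j k)).add ?_
    split_ifs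
    · exact contDiffOn_const
    · exact hy j _
  · intro j k hk η hη
    dsimp only
    rw [hlie0 j k (by omega) η hη, zero_add]
    split_ifs with h0
    · rfl
    · exact hvan j _ (by omega) η hη
  · dsimp only
    rw [hlie0 j₀ (k₀ + 1) (by omega) η hη, if_neg (Nat.succ_ne_zero _), zero_add]
    exact htop η hη
  · have h1 := fderiv_lieD_of_relation (ι := Σ j : Fin 2, Fin (R j + 1)) hU.isOpen hU.totalField
      (h := fun _ => 0) (g := fun i => outDeriv f N φ i.1 i.2) (c := fun i => y i.1 i.2)
      contDiffOn_const (fun i => hU.outDeriv _ _) (fun i => hy _ _) (fun ζ hζ w => by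
        have := hrel ζ hζ w
        simp only [Finset.sum_range] at this
        rw [Fintype.sum_sigma, this]
        simp) hη v
    have h2 : fderiv ℝ (_root_.lieD τ (fun _ => 0 : JetSp n N → ℝ)) η v = 0 := by
      rw [show _root_.lieD τ (fun _ => 0 : JetSp n N → ℝ) = fun _ => 0 by
        funext ζ; simp [_root_.lieD]]
      simp
    rw [h2, Fintype.sum_sigma] at h1
    refine Eq.trans ?_ h1.symm
    refine Finset.sum_congr rfl fun j _ => ?_
    rw [← Finset.sum_range (f := fun k => _root_.lieD τ (y j k) η *
      fderiv ℝ (outDeriv f N φ j k) η v + y j k η *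
      fderiv ℝ (_root_.lieD τ (outDeriv f N φ j k)) η v)]
    simp only [add_mul, Finset.sum_add_distrib]
    congr 1
    -- The shift does not leave the index range, since the coefficient of φ^j_[R j] vanishes.
    rw [Finset.sum_range_succ', Finset.sum_range_succ _ (R j), hvan j (R j) (by omega) η hη]
    simp [outDeriv_succ, τ]

/-- A relation can be lifted until it involves some φ^j_[r_j]. Then one top differential is
redundant modulo the rest, and the remaining ones cannot determine u. -/
theorem IsRegularDomain.not_hasRelation (h : IsRegularDomain f φ R κ e c c' V)
    {U : Set (JetSp n N)} (hU : IsOpen U) (hUV : U ⊆ V) (hne : U.Nonempty) (s : ℕ) :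
    ¬ HasRelation f φ R s U := by
  induction s with
  | succ s ih => exact fun hrel => ih (hrel.lieD (h.dom.mono hU hUV))
  | zero =>
    rintro ⟨y, -, -, ⟨j₀, k₀, hk₀, htop⟩, hrel⟩
    obtain ⟨η, hηU⟩ := hne
    have hη := hUV hηU
    have heN := h.add_one_le
    have hrel' : ∀ v, (∀ j, ∀ k < R j, fderiv ℝ (outDeriv f N φ j k) η v = 0) →
        y 0 (R 0) η * fderiv ℝ (outDeriv f N φ 0 (R 0)) η v +
        y 1 (R 1) η * fderiv ℝ (outDeriv f N φ 1 (R 1)) η v = 0 := by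
      intro v hv
      have := hrel η hηU v
      rwa [Fin.sum_univ_two, Finset.sum_range_succ, Finset.sum_range_succ,
        Finset.sum_eq_zero, Finset.sum_eq_zero, zero_add, zero_add] at this
      · intro k hk; rw [hv 1 k (Finset.mem_range.1 hk), mul_zero]
      · intro k hk; rw [hv 0 k (Finset.mem_range.1 hk), mul_zero]
    have hy : y 0 (R 0) η ≠ 0 ∨ y 1 (R 1) η ≠ 0 := by
      obtain rfl : k₀ = R j₀ := hk₀
      have := htop η hηU
      fin_cases j₀
      · exact Or.inl this
      · exact Or.inr this
    have hz : ∀ t, ∀ l < e, jetU l (jetSingle e t : JetSp n N) = 0 := fun t l hl => by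
      rw [jetU_jetSingle (by omega), if_neg hl.ne]
    have hlow : ∀ t : InputSp, ∀ j, ∀ k < R j,
        fderiv ℝ (outDeriv f N φ j k) η (jetSingle e t) = 0 := fun t j k hk =>
      (h.free j).hasOrd_of_lt h.dom (h.one_le j)
        (show k < κ j + e by rwa [← h.order j]) η hη _ rfl (hz t)
    have hval : ∀ t : InputSp, ∀ j, fderiv ℝ (outDeriv f N φ j (R j)) η (jetSingle e t) =
        inputDeriv f φ j (κ j) η t := fun t j => by
      rw [h.order j, h.fderiv_lead j (by omega) hη rfl (hz t), jetU_jetSingle (by omega),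
        if_pos rfl]
    have hsum := fun t => hrel' (jetSingle e t) (hlow t)
    simp only [hval] at hsum
    -- For e = 0 the two top derivatives would be proportional in u. For e ≥ 1, φ²_[r₂] would be
    -- redundant, contradicting the existence of a direction that moves u^c but not x or φ¹_[≤r₁].
    rcases Nat.eq_zero_or_pos e with rfl | he
    · obtain ⟨d, hd, hdu⟩ := (h.flat η hη).input_top
      have hdu' := fun t => hdu (jetSingle 0 t) (hlow t)
      simp only [hval, jetU_jetSingle (Nat.zero_le N), if_true] at hdu'
      rcases hy with hy | hy
      · refine not_forall_eq_smul (inputDeriv f φ 1 (κ 1) η)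
          (-(y 1 (R 1) η / y 0 (R 0) η) • d 0 + d 1) fun t => ?_
        have h1 : inputDeriv f φ 0 (κ 0) η t =
            -(y 1 (R 1) η / y 0 (R 0) η) * inputDeriv f φ 1 (κ 1) η t := by
          field_simp
          linarith [hsum t]
        have h2 := hdu' t
        rw [h1] at h2
        rw [smul_add, smul_smul, mul_comm]
        exact h2
      · refine not_forall_eq_smul (inputDeriv f φ 0 (κ 0) η)
          (d 0 + -(y 0 (R 0) η / y 1 (R 1) η) • d 1) fun t => ?_
        have h1 : inputDeriv f φ 1 (κ 1) η t =
            -(y 0 (R 0) η / y 1 (R 1) η) * inputDeriv f φ 0 (κ 0) η t := by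
          field_simp
          linarith [hsum t]
        have h2 := hdu' t
        rw [h1] at h2
        rw [smul_add, smul_smul, mul_comm _ (-(y 0 (R 0) η / y 1 (R 1) η))]
        exact h2
    · have hy1 : y 1 (R 1) η ≠ 0 := fun h1 => by
        have h2 := hsum (Pi.single c' 1)
        rw [h1, zero_mul, add_zero] at h2
        exact mul_ne_zero (hy.resolve_right (not_not.2 h1)) (h.lead η hη) h2
      obtain ⟨v, hv, hv1⟩ := h.exists_inKer hη (a := e + 1) (b := 0) (by omega) (by omega)
      have h0 : ∀ k ≤ R 0, fderiv ℝ (outDeriv f N φ 0 k) η v = 0 := fun k hk =>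
        h.fderiv_out_zero hη hv (by rw [← add_assoc, ← h.order 0]; exact Nat.lt_succ_of_le hk)
      have h1 : ∀ k < R 1, fderiv ℝ (outDeriv f N φ 1 k) η v = 0 := fun k hk =>
        h.fderiv_out_one_of_lt hη (hv.mono (Nat.le_succ e) le_rfl) hk
      have h2 := hrel' v fun j k hk => by
        fin_cases j
        · exact h0 k hk.le
        · exact h1 k hk
      rw [h0 _ le_rfl, mul_zero, zero_add] at h2
      have h3 := (mul_eq_zero.1 h2).resolve_left hy1
      have h4 : jetU 0 v = 0 := (h.flat η hη).input_eq_zero fun j k hk => by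
        fin_cases j
        · exact h0 k hk
        · rcases Nat.lt_or_eq_of_le hk with hlt | heq
          · exact h1 k hlt
          · subst heq; exact h3
      rw [h4] at hv1
      simp at hv1

/-- The differentials of the `φ^j_[k]`, `k < R j`, are independent somewhere. -/
theorem IsRegularDomain.exists_indepAt (h : IsRegularDomain f φ R κ e c c' V)
    (hne : V.Nonempty) : ∃ η ∈ V,
      IndepAt (fun i : (Σ j : Fin 2, Fin (R j)) => outDeriv f N φ i.1 i.2) η := by
  classical
  rcases exists_indepAt_or_relation h.dom.isOpen hne
    (g := fun i : (Σ j : Fin 2, Fin (R j)) => outDeriv f N φ i.1 i.2)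
    fun i => h.dom.outDeriv _ _ with hi | ⟨U, hUV, hU, ⟨ξ, hξ⟩, y, hy, ⟨i₀, hi₀⟩, hrel⟩
  · exact hi
  exfalso
  let z : Fin 2 → ℕ → JetSp n N → ℝ := fun j k => if hk : k < R j then y ⟨j, k, hk⟩ else fun _ => 0
  -- The least s belongs to the derivative closest to order R_j whose coefficient is not identically
  -- zero; the domain is shrunk to where it does not vanish.
  have hex : ∃ s, ∃ j k, k + s = R j ∧ ∃ η ∈ U, z j k η ≠ 0 := by
    refine ⟨R i₀.1 - i₀.2, i₀.1, i₀.2, by omega, ξ, hξ, ?_⟩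
    simp [z, hi₀ ξ hξ]
  obtain ⟨j, k, hk, η, hη, hz⟩ := Nat.find_spec hex
  have hmin := fun m hm => Nat.find_min hex (m := m) hm
  have hzs : ∀ j k, ContDiffOn ℝ ∞ (z j k) U := fun j k => by
    by_cases hk : k < R j
    · simp only [z, hk, dite_true]; exact hy _
    · simp only [z, hk, dite_false]; exact contDiffOn_const
  have hU' : IsOpen (U ∩ z j k ⁻¹' {0}ᶜ) :=
    (hzs j k).continuousOn.isOpen_inter_preimage hU isOpen_compl_singleton
  refine h.not_hasRelation hU' (inter_subset_left.trans hUV) ⟨η, hη, hz⟩ (Nat.find hex)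
    ⟨z, fun j k => (hzs j k).mono inter_subset_left, ?_, ⟨j, k, hk, fun ζ hζ => hζ.2⟩, ?_⟩
  · intro j' k' hlt ζ hζ
    by_cases hk' : k' < R j'
    · by_contra hne'
      exact hmin (R j' - k') (by omega) ⟨j', k', by omega, ζ, hζ.1, hne'⟩
    · simp [z, hk']
  · intro ζ hζ v
    have := hrel ζ hζ.1 v
    rw [Fintype.sum_sigma] at this
    rw [← this]
    refine Finset.sum_congr rfl fun j _ => ?_
    rw [Finset.sum_range_succ, Finset.sum_range]
    simp [z]

/-- The R 0 + R 1 differentials of φ_[0,R-1] and the n + e differentials of x, φ¹_[κ₁], …,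
φ¹_[κ₁+e-1] have the same common kernel, and both families are independent. -/
theorem IsRegularDomain.sum_order (h : IsRegularDomain f φ R κ e c c' V) (hne : V.Nonempty) :
    R 0 + R 1 = n + e := by
  obtain ⟨η, hη, hi⟩ := h.exists_indepAt hne
  have heN := h.add_one_le
  have h1 := hi.card_le (g' := adapted f φ κ c e 0) fun v hv => by
    have hv := inKer_iff.2 hv
    rintro ⟨j, k, hk⟩
    fin_cases j
    · exact h.fderiv_out_zero hη hv (by rw [← h.order 0]; exact hk)
    · exact h.fderiv_out_one_of_lt hη hv hk
  have h2 := (h.indepAt_adapted hη (Nat.zero_le e) (by omega)).card_le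
    (g' := fun i : (Σ j : Fin 2, Fin (R j)) => outDeriv f N φ i.1 i.2) fun v hv => by
      refine inKer_iff.1 ⟨(h.flat η hη).state v fun j k hk => hv ⟨j, k, hk⟩, fun l hl =>
        hv ⟨0, κ 0 + l, by rw [h.order 0]; omega⟩, fun l hl => absurd hl (Nat.not_lt_zero l)⟩
  simp at h1 h2
  omega

end Independence

/-! ### Local diffeomorphisms -/

section LocalDiffeo

variable {E E' : Type*} [NormedAddCommGroup E] [NormedSpace ℝ E] [FiniteDimensional ℝ E]
  [NormedAddCommGroup E'] [NormedSpace ℝ E'] [FiniteDimensional ℝ E']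

/-- The inverse function theorem for smooth maps with injective differentials between spaces of
the same dimension. -/
theorem exists_openPartialHomeomorph_of_injective {F : E → E'} {U : Set E} (hU : IsOpen U)
    (hF : ContDiffOn ℝ ∞ F U) (hdim : Module.finrank ℝ E = Module.finrank ℝ E')
    (hinj : ∀ x ∈ U, ∀ v, fderiv ℝ F x v = 0 → v = 0) {x : E} (hx : x ∈ U) :
    ∃ e : OpenPartialHomeomorph E E', x ∈ e.source ∧ e.source ⊆ U ∧ (∀ y, e y = F y) ∧
      ContDiffOn ℝ ∞ e.symm e.target := by
  have hequiv : ∀ y ∈ U, ∃ f' : E ≃L[ℝ] E', HasFDerivAt F (f' : E →L[ℝ] E') y := fun y hy => by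
    have hi : Function.Injective (fderiv ℝ F y).toLinearMap :=
      (injective_iff_map_eq_zero _).2 (hinj y hy)
    refine ⟨(LinearMap.linearEquivOfInjective _ hi hdim).toContinuousLinearEquiv, ?_⟩
    convert (hF.differentiableAt_of_isOpen hU hy).hasFDerivAt
    ext v
    rfl
  obtain ⟨f', hf'⟩ := hequiv x hx
  have hFx := hF.contDiffAt (hU.mem_nhds hx)
  have hxs := hFx.mem_toOpenPartialHomeomorph_source hf' (by simp)
  refine ⟨(hFx.toOpenPartialHomeomorph F hf' (by simp)).restrOpen U hU, ⟨hxs, hx⟩,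
    fun y hy => hy.2, fun y => rfl, fun z hz => ContDiffAt.contDiffWithinAt ?_⟩
  set e := (hFx.toOpenPartialHomeomorph F hf' (by simp)).restrOpen U hU
  have hzU : e.symm z ∈ U := (e.map_target hz).2
  obtain ⟨g', hg'⟩ := hequiv _ hzU
  exact e.contDiffAt_symm hz hg' (hF.contDiffAt (hU.mem_nhds hzU))

theorem isLocalDiffeomorphAt_of_injective {F : E → E'} {U : Set E} (hU : IsOpen U)
    (hF : ContDiffOn ℝ ∞ F U) (hdim : Module.finrank ℝ E = Module.finrank ℝ E')
    (hinj : ∀ x ∈ U, ∀ v, fderiv ℝ F x v = 0 → v = 0) {x : E} (hx : x ∈ U) :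
    IsLocalDiffeomorphAt 𝓘(ℝ, E) 𝓘(ℝ, E') ∞ F x := by
  obtain ⟨e, hxe, heU, heF, hes⟩ :=
    exists_openPartialHomeomorph_of_injective hU hF hdim hinj hx
  refine ⟨⟨e.toPartialEquiv, e.open_source, e.open_target, ?_, ?_⟩, hxe, fun y _ => (heF y).symm⟩
  · exact contMDiffOn_iff_contDiffOn.2 ((hF.mono heU).congr fun y _ => heF y)
  · exact contMDiffOn_iff_contDiffOn.2 hes

theorem eq_of_fderiv_eq_zero {E : Type*} [NormedAddCommGroup E] [NormedSpace ℝ E] {h : E → ℝ}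
    {V : Set E} (hV : Convex ℝ V) (hh : ∀ x ∈ V, DifferentiableAt ℝ h x) {x y : E} (hx : x ∈ V)
    (hy : y ∈ V) (h0 : ∀ z ∈ V, fderiv ℝ h z (y - x) = 0) : h x = h y := by
  obtain ⟨z, hz, hzeq⟩ := domain_mvt (f' := fderiv ℝ h)
    (fun w hw => (hh w hw).hasFDerivAt.hasFDerivWithinAt) hV hx hy
  rw [h0 z (hV.segment_subset hx hy hz)] at hzeq
  linarith

end LocalDiffeo

/-! ### Coordinates of the general triangular form from functions on the jet space -/

section Assembly

variable {n N : ℕ} {f : StateSp n × InputSp → StateSp n} {φ : StateSp n → Fin 2 → ℝ}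
  {V : Set (JetSp n N)} {p : ℕ}

/-- The segment between the two jets stays in V by convexity, and the differential vanishes along
it. This turns the infinitesimal notion of order into actual dependence. -/
theorem HasOrd.eq_of_coords {h : JetSp n N → ℝ} (hV : Convex ℝ V)
    (hh : ∀ x ∈ V, DifferentiableAt ℝ h x) (ho : HasOrd h p V) {η ζ : JetSp n N} (hη : η ∈ V)
    (hζ : ζ ∈ V) (h1 : η.1 = ζ.1) (h2 : ∀ l < p, jetU l η = jetU l ζ) : h η = h ζ :=
  eq_of_fderiv_eq_zero hV hh hη hζ fun z hz => ho z hz _ (by simp [h1]) fun l hl => by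
    rw [map_sub, h2 l hl, sub_self]

theorem HasOrd.fderiv_eq_of_coords {h : JetSp n N → ℝ} (hV : Convex ℝ V) (hVo : IsOpen V)
    (hh : ∀ x ∈ V, DifferentiableAt ℝ h x) (ho : HasOrd h p V) {η ζ : JetSp n N} (hη : η ∈ V)
    (hζ : ζ ∈ V) (h1 : η.1 = ζ.1) (h2 : ∀ l < p, jetU l η = jetU l ζ) :
    fderiv ℝ h η = fderiv ℝ h ζ := by
  have hev : h =ᶠ[𝓝 η] fun θ => h (θ + (ζ - η)) := by
    have hc : ContinuousAt (fun θ : JetSp n N => θ + (ζ - η)) η := by fun_prop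
    have hmem : V ∈ 𝓝 (η + (ζ - η)) := by rw [add_sub_cancel]; exact hVo.mem_nhds hζ
    filter_upwards [hVo.mem_nhds hη, hc hmem] with θ hθ hθ'
    refine ho.eq_of_coords hV hh hθ hθ' ?_ fun l hl => ?_
    · simp [h1]
    · rw [map_add, map_sub, h2 l hl, sub_self, add_zero]
  rw [hev.fderiv_eq, fderiv_comp_add_right, add_sub_cancel]

/-! ### Passage between prolonged states and jets -/

/-- The sequence `u, u_[1], …, u_[p], 0, …` at a point of the state-input space of the
prolongation. -/
def inputSeq (q : ProlongedSp n p × InputSp) (l : ℕ) : InputSp :=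
  if h : l < p then q.1.2 ⟨l, h⟩ else if l = p then q.2 else 0

/-- The inclusion of the state-input space of the prolongation into the jet space. -/
noncomputable def jetIncl (n N p : ℕ) : ProlongedSp n p × InputSp →L[ℝ] JetSp n N :=
  LinearMap.toContinuousLinearMap
    { toFun := fun q => (q.1.1, fun l => inputSeq q l)
      map_add' := fun q q' => by
        refine Prod.ext rfl (funext fun l => ?_)
        simp only [inputSeq, Prod.snd_add, Prod.fst_add, Pi.add_apply]
        split_ifs <;> simp
      map_smul' := fun r q => by
        refine Prod.ext rfl (funext fun l => ?_)
        simp only [inputSeq, Prod.smul_snd, Prod.smul_fst, Pi.smul_apply, RingHom.id_apply]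
        split_ifs <;> simp }

theorem jetIncl_fst (q : ProlongedSp n p × InputSp) : (jetIncl n N p q).1 = q.1.1 := rfl

theorem jetU_jetIncl (q : ProlongedSp n p × InputSp) {l : ℕ} (hl : l ≤ N) :
    jetU l (jetIncl n N p q) = inputSeq q l := by
  rw [jetU_of_lt (Nat.lt_succ_of_le hl)]; rfl

theorem jetIncl_zero_left (t : InputSp) : jetIncl n N p (0, t) = jetSingle p t := by
  refine Prod.ext rfl (funext fun l => ?_)
  show inputSeq ((0 : ProlongedSp n p), t) l = if (l : ℕ) = p then t else 0
  unfold inputSeq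
  split_ifs with h1 h2
  · omega
  · rfl
  · rfl
  · rfl

theorem inputSeq_prolong (q : ProlongedSp n p × InputSp) (t : InputSp) {l : ℕ} (hl : l < p) :
    inputSeq (prolong f p q, t) l = inputSeq q (l + 1) := by
  simp only [inputSeq, hl, dite_true, prolong, Fin.succ_mk, Fin.snoc]
  by_cases h : l + 1 < p
  · simp [h]
  · simp [show l + 1 = p by omega]

theorem prolong_fst (q : ProlongedSp n p × InputSp) :
    (prolong f p q).1 = f (q.1.1, inputSeq q 0) := by
  simp only [inputSeq, prolong, Fin.snoc]
  by_cases h : 0 < p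
  · simp [h]; rfl
  · have : p = 0 := by omega
    simp [this]

/-- The jet with the first coordinates of `q` and the remaining ones of `ξ`. -/
noncomputable def jetLift (hp : p ≤ N) (ξ : JetSp n N) (q : ProlongedSp n p × InputSp) :
    JetSp n N := ξ + jetIncl n N p (q - ξ.trunc p hp)

theorem inputSeq_trunc (hp : p ≤ N) (ξ : JetSp n N) {l : ℕ} (hl : l ≤ p) :
    inputSeq (ξ.trunc p hp) l = jetU l ξ := by
  rw [jetU_of_lt (by omega)]
  unfold inputSeq JetSp.trunc
  split_ifs with h1 h2
  · rfl
  · subst h2; rfl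
  · omega

theorem inputSeq_sub (q q' : ProlongedSp n p × InputSp) (l : ℕ) :
    inputSeq (q - q') l = inputSeq q l - inputSeq q' l := by
  unfold inputSeq
  split_ifs <;> simp

theorem jetLift_fst (hp : p ≤ N) (ξ : JetSp n N) (q : ProlongedSp n p × InputSp) :
    (jetLift hp ξ q).1 = q.1.1 := by
  simp [jetLift, jetIncl_fst, JetSp.trunc]

theorem jetU_jetLift (hp : p ≤ N) (ξ : JetSp n N) (q : ProlongedSp n p × InputSp) {l : ℕ}
    (hl : l ≤ p) : jetU l (jetLift hp ξ q) = inputSeq q l := by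
  rw [jetLift, map_add, jetU_jetIncl _ (hl.trans hp), inputSeq_sub, inputSeq_trunc hp ξ hl]
  abel

theorem jetLift_trunc (hp : p ≤ N) (ξ : JetSp n N) : jetLift hp ξ (ξ.trunc p hp) = ξ := by
  simp [jetLift]

theorem hasFDerivAt_jetLift (hp : p ≤ N) (ξ : JetSp n N) (q : ProlongedSp n p × InputSp) :
    HasFDerivAt (jetLift hp ξ) (jetIncl n N p) q := by
  have := ((jetIncl n N p).hasFDerivAt.comp q
    ((hasFDerivAt_id q).sub_const (ξ.trunc p hp))).const_add ξ
  rwa [ContinuousLinearMap.comp_id] at this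

theorem contDiff_jetLift (hp : p ≤ N) (ξ : JetSp n N) :
    ContDiff ℝ ∞ (jetLift hp ξ : ProlongedSp n p × InputSp → JetSp n N) :=
  contDiff_const.add ((jetIncl n N p).contDiff.comp (contDiff_id.sub contDiff_const))

theorem inputSeq_of_lt (q : ProlongedSp n p × InputSp) {l : ℕ} (hl : l < p) :
    inputSeq q l = q.1.2 ⟨l, hl⟩ := dif_pos hl

/-- Functions on the jet space which are coordinates of the general triangular form. -/
structure IsGTFSystem (f : StateSp n × InputSp → StateSp n) (φ : StateSp n → Fin 2 → ℝ)
    (p k₁ k₂ : ℕ) (H : Fin (n + 2 * p) → JetSp n N → ℝ) (G : Fin 2 → JetSp n N → ℝ)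
    (A B : Fin (n + 2 * p) → JetSp n N → ℝ) (V : Set (JetSp n N)) : Prop where
  one_le_left : 1 ≤ k₁
  one_le_right : 1 ≤ k₂
  add_le : k₁ + k₂ ≤ n + 2 * p
  smooth_coord : ∀ i, ContDiffOn ℝ ∞ (H i) V
  order_coord : ∀ i, HasOrd (H i) p V
  smooth_input : ∀ i, ContDiffOn ℝ ∞ (G i) V
  smooth_left : ∀ i, ContDiffOn ℝ ∞ (A i) V
  order_left : ∀ i, HasOrd (A i) p V
  smooth_right : ∀ i, ContDiffOn ℝ ∞ (B i) V
  order_right : ∀ i, HasOrd (B i) p V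
  coord_inj : ∀ η ∈ V, ∀ v, (∀ i, fderiv ℝ (H i) η v = 0) → v.1 = 0 ∧ ∀ l < p, jetU l v = 0
  input_inj : ∀ η ∈ V, ∀ t, (∀ i, fderiv ℝ (G i) η (jetSingle p t) = 0) → t = 0
  coord_out : ∀ i : Fin (n + 2 * p), ((i : ℕ) = 0 → H i = outDeriv f N φ 0 0) ∧
    ((i : ℕ) = k₁ → H i = outDeriv f N φ 1 0)
  dynamics : ∀ η ∈ V, ∀ i : Fin (n + 2 * p), lieD (totalField f N) (H i) η =
    if h : (i : ℕ) + 1 < n + 2 * p then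
      if (i : ℕ) + 1 = k₁ then G 0 η
      else if (i : ℕ) + 1 < k₁ + k₂ then H ⟨i + 1, h⟩ η
      else A i η + B i η * G 0 η
    else G 1 η
  depends : ∀ i : Fin (n + 2 * p), k₁ + k₂ ≤ (i : ℕ) + 1 → (i : ℕ) + 1 < n + 2 * p → ∀ η ∈ V,
    ∀ v, (∀ j : Fin (n + 2 * p), (j : ℕ) ≤ i + 1 → fderiv ℝ (H j) η v = 0) →
      fderiv ℝ (A i) η v = 0 ∧ fderiv ℝ (B i) η v = 0
  regular : ∀ (i : Fin (n + 2 * p)) (h : (i : ℕ) + 1 < n + 2 * p), k₁ + k₂ ≤ (i : ℕ) + 1 →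
    ∀ η ∈ V, ∀ v, (∀ j : Fin (n + 2 * p), (j : ℕ) ≤ i → fderiv ℝ (H j) η v = 0) →
      fderiv ℝ (H ⟨i + 1, h⟩) η v = 1 → fderiv ℝ (A i) η v ≠ 0 ∨ fderiv ℝ (B i) η v ≠ 0
  first_ne_zero : ∀ i : Fin (n + 2 * p), k₁ + k₂ = (i : ℕ) + 1 → (i : ℕ) + 1 < n + 2 * p →
    ∀ η ∈ V, B i η ≠ 0

theorem IsGTFSystem.mono {k₁ k₂ : ℕ} {H A B : Fin (n + 2 * p) → JetSp n N → ℝ}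
    {G : Fin 2 → JetSp n N → ℝ} {V' : Set (JetSp n N)} (h : IsGTFSystem f φ p k₁ k₂ H G A B V)
    (hsub : V' ⊆ V) : IsGTFSystem f φ p k₁ k₂ H G A B V' where
  one_le_left := h.one_le_left
  one_le_right := h.one_le_right
  add_le := h.add_le
  smooth_coord i := (h.smooth_coord i).mono hsub
  order_coord i := (h.order_coord i).mono_set hsub
  smooth_input i := (h.smooth_input i).mono hsub
  smooth_left i := (h.smooth_left i).mono hsub
  order_left i := (h.order_left i).mono_set hsub
  smooth_right i := (h.smooth_right i).mono hsub
  order_right i := (h.order_right i).mono_set hsub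
  coord_inj η hη := h.coord_inj η (hsub hη)
  input_inj η hη := h.input_inj η (hsub hη)
  coord_out := h.coord_out
  dynamics η hη := h.dynamics η (hsub hη)
  depends i h1 h2 η hη := h.depends i h1 h2 η (hsub hη)
  regular i h1 h2 η hη := h.regular i h1 h2 η (hsub hη)
  first_ne_zero i h1 h2 η hη := h.first_ne_zero i h1 h2 η (hsub hη)

theorem IsGTFSystem.isSFEToGTFAt_of_convex {k₁ k₂ : ℕ} {H A B : Fin (n + 2 * p) → JetSp n N → ℝ}
    {G : Fin 2 → JetSp n N → ℝ} (h : IsGTFSystem f φ p k₁ k₂ H G A B V) (hV : IsOpen V)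
    (hVc : Convex ℝ V) (hp : p ≤ N) {ξ : JetSp n N} (hξ : ξ ∈ V) :
    IsSFEToGTFAt f φ p (ξ.trunc p hp) := by
  set q₀ := ξ.trunc p hp with hq₀
  let lift : ProlongedSp n p × InputSp → JetSp n N := jetLift hp ξ
  -- The section freezes u_[p] at its value in q₀, and `lift` freezes all higher orders at those of
  -- ξ; functions of order p are not affected.
  let sec : ProlongedSp n p → JetSp n N := fun s => lift (s, q₀.2)
  have hlift_smooth : ContDiff ℝ ∞ lift := contDiff_jetLift hp ξ
  have hsec_smooth : ContDiff ℝ ∞ sec := hlift_smooth.comp (contDiff_id.prodMk contDiff_const)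
  have hsec_deriv : ∀ s, HasFDerivAt sec ((jetIncl n N p).comp
      (ContinuousLinearMap.inl ℝ _ _)) s := fun s =>
    HasFDerivAt.comp (f := fun s => (s, q₀.2)) s (hasFDerivAt_jetLift hp ξ (s, q₀.2))
      (hasFDerivAt_prodMk_left s q₀.2)
  have hlift₀ : lift q₀ = ξ := jetLift_trunc hp ξ
  have hdiff : ∀ {K : JetSp n N → ℝ}, ContDiffOn ℝ ∞ K V → ∀ x ∈ V, DifferentiableAt ℝ K x :=
    fun hK x hx => hK.differentiableAt_of_isOpen hV hx
  -- the state transformation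
  let Φx : ProlongedSp n p → (Fin (n + 2 * p) → ℝ) := fun s i => H i (sec s)
  let Φu : ProlongedSp n p × InputSp → InputSp := fun q i => G i (lift q)
  have hS : IsOpen (sec ⁻¹' V) := hV.preimage hsec_smooth.continuous
  have hq₀S : q₀.1 ∈ sec ⁻¹' V := by
    show lift q₀ ∈ V
    rwa [hlift₀]
  have hΦx_smooth : ContDiffOn ℝ ∞ Φx (sec ⁻¹' V) := contDiffOn_pi.2 fun i =>
    (h.smooth_coord i).comp hsec_smooth.contDiffOn fun s hs => hs
  have hΦx_deriv : ∀ s ∈ sec ⁻¹' V, ∀ v i,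
      fderiv ℝ Φx s v i = fderiv ℝ (H i) (sec s) (jetIncl n N p (v, 0)) := by
    intro s hs v i
    have h1 : HasFDerivAt Φx (ContinuousLinearMap.pi fun i => (fderiv ℝ (H i) (sec s)).comp
        ((jetIncl n N p).comp (ContinuousLinearMap.inl ℝ _ _))) s :=
      hasFDerivAt_pi.2 fun i =>
        ((hdiff (h.smooth_coord i) _ hs).hasFDerivAt).comp s (hsec_deriv s)
    rw [h1.fderiv]
    rfl
  have hincl_zero : ∀ v : ProlongedSp n p, (jetIncl n N p (v, 0)).1 = 0 →
      (∀ l < p, jetU l (jetIncl n N p (v, 0)) = 0) → v = 0 := by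
    intro v h1 h2
    refine Prod.ext h1 (funext fun l => ?_)
    have := h2 l l.2
    rwa [jetU_jetIncl _ (by omega), inputSeq_of_lt _ l.2] at this
  have hΦx_inj : ∀ s ∈ sec ⁻¹' V, ∀ v, fderiv ℝ Φx s v = 0 → v = 0 := by
    intro s hs v hv
    obtain ⟨h1, h2⟩ := h.coord_inj (sec s) hs (jetIncl n N p (v, 0)) fun i => by
      rw [← hΦx_deriv s hs, hv]; rfl
    exact hincl_zero v h1 h2
  have hdim : Module.finrank ℝ (ProlongedSp n p) = Module.finrank ℝ (Fin (n + 2 * p) → ℝ) := by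
    simp [Module.finrank_pi_fintype, mul_comm]
  obtain ⟨e, hq₀e, heS, heΦ, hes⟩ :=
    exists_openPartialHomeomorph_of_injective hS hΦx_smooth hdim hΦx_inj hq₀S
  have hz₀ : Φx q₀.1 ∈ e.target := heΦ q₀.1 ▸ e.map_source hq₀e
  -- A ball, being convex, lets the condition on differentials imply that a^l, b^l depend on z¹, …,
  -- z^{l+1} only.
  obtain ⟨ρ, hρ, hρt⟩ := Metric.isOpen_iff.1 e.open_target _ hz₀
  -- functions in the new coordinates
  have hsecψ : ∀ z ∈ Metric.ball (Φx q₀.1) ρ, sec (e.symm z) ∈ V := fun z hz =>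
    heS (e.map_target (hρt hz))
  have hcomp_smooth : ∀ {K : JetSp n N → ℝ}, ContDiffOn ℝ ∞ K V →
      ContDiffOn ℝ ∞ (fun z => K (sec (e.symm z))) (Metric.ball (Φx q₀.1) ρ) := fun hK =>
    hK.comp (hsec_smooth.comp_contDiffOn (hes.mono hρt)) hsecψ
  have hcomp_deriv : ∀ {K : JetSp n N → ℝ}, ContDiffOn ℝ ∞ K V →
      ∀ z ∈ Metric.ball (Φx q₀.1) ρ, ∀ w, fderiv ℝ (fun z => K (sec (e.symm z))) z w =
        fderiv ℝ K (sec (e.symm z)) (jetIncl n N p (fderiv ℝ e.symm z w, 0)) := by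
    intro K hK z hz w
    have h1 : HasFDerivAt e.symm (fderiv ℝ e.symm z) z :=
      (hes.differentiableAt_of_isOpen e.open_target (hρt hz)).hasFDerivAt
    have h2 : HasFDerivAt (fun z => K (sec (e.symm z))) _ z :=
      ((hdiff hK _ (hsecψ z hz)).hasFDerivAt).comp z ((hsec_deriv _).comp z h1)
    rw [h2.fderiv]
    rfl
  have hcoord : ∀ z ∈ Metric.ball (Φx q₀.1) ρ, ∀ w i,
      fderiv ℝ (H i) (sec (e.symm z)) (jetIncl n N p (fderiv ℝ e.symm z w, 0)) = w i := by
    intro z hz w i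
    rw [← hcomp_deriv (h.smooth_coord i) z hz]
    have : (fun z => H i (sec (e.symm z))) =ᶠ[𝓝 z] fun z => z i := by
      filter_upwards [Metric.isOpen_ball.mem_nhds hz] with z' hz'
      have := congrFun (e.right_inv (hρt hz')) i
      rwa [heΦ] at this
    have hproj : HasFDerivAt (fun z : Fin (n + 2 * p) → ℝ => z i) _ z :=
      (ContinuousLinearMap.proj (R := ℝ) (φ := fun _ : Fin (n + 2 * p) => ℝ) i).hasFDerivAt
    rw [this.fderiv_eq, hproj.fderiv]
    rfl
  have hdep : ∀ {K : JetSp n N → ℝ}, ContDiffOn ℝ ∞ K V → ∀ m : ℕ, (∀ η ∈ V, ∀ v,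
      (∀ j : Fin (n + 2 * p), (j : ℕ) ≤ m → fderiv ℝ (H j) η v = 0) → fderiv ℝ K η v = 0) →
      ∀ z ∈ Metric.ball (Φx q₀.1) ρ, ∀ z' ∈ Metric.ball (Φx q₀.1) ρ,
      (∀ j : Fin (n + 2 * p), (j : ℕ) ≤ m → z j = z' j) →
      K (sec (e.symm z)) = K (sec (e.symm z')) := by
    intro K hK m hKm z hz z' hz' hzz'
    refine eq_of_fderiv_eq_zero (h := fun z => K (sec (e.symm z)))
      (convex_ball (Φx q₀.1) ρ) (fun x hx =>
      (hcomp_smooth hK).differentiableAt_of_isOpen Metric.isOpen_ball hx) hz hz' fun y hy => ?_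
    rw [hcomp_deriv hK y hy]
    refine hKm _ (hsecψ y hy) _ fun j hj => ?_
    rw [hcoord y hy, Pi.sub_apply, hzz' j hj, sub_self]
  refine ⟨k₁, k₂, fun i z => A i (sec (e.symm z)), fun i z => B i (sec (e.symm z)),
    Metric.ball (Φx q₀.1) ρ, Φx, Φu, ⟨h.one_le_left, h.one_le_right, h.add_le,
      Metric.isOpen_ball, ?_, ?_, ?_, ?_⟩, Metric.mem_ball_self hρ, ⟨?_, ?_, ?_⟩, ?_⟩
  · exact fun i _ _ => ⟨hcomp_smooth (h.smooth_left i), hcomp_smooth (h.smooth_right i)⟩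
  · intro i h1 h2 z hz z' hz' hzz'
    exact ⟨hdep (h.smooth_left i) (i + 1) (fun η hη v hv => (h.depends i h1 h2 η hη v hv).1)
        z hz z' hz' hzz',
      hdep (h.smooth_right i) (i + 1) (fun η hη v hv => (h.depends i h1 h2 η hη v hv).2)
        z hz z' hz' hzz'⟩
  · intro i hi h1 z hz
    rw [hcomp_deriv (h.smooth_left i) z hz, hcomp_deriv (h.smooth_right i) z hz]
    refine h.regular i hi h1 _ (hsecψ z hz) _ (fun j hj => ?_) ?_
    · rw [hcoord z hz, Pi.single_eq_of_ne]
      rintro rfl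
      exact absurd hj (by simp)
    · rw [hcoord z hz, Pi.single_eq_same]
  · exact fun i h1 h2 z hz => h.first_ne_zero i h1 h2 _ (hsecψ z hz)
  · exact isLocalDiffeomorphAt_of_injective hS hΦx_smooth hdim hΦx_inj hq₀S
  · have hQ : IsOpen (lift ⁻¹' V ∩ Prod.fst ⁻¹' (sec ⁻¹' V)) :=
      (hV.preimage hlift_smooth.continuous).inter (hS.preimage continuous_fst)
    have hΦu_smooth : ContDiffOn ℝ ∞ Φu (lift ⁻¹' V) := contDiffOn_pi.2 fun i =>
      (h.smooth_input i).comp hlift_smooth.contDiffOn fun s hs => hs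
    refine isLocalDiffeomorphAt_of_injective hQ
      ((hΦx_smooth.comp contDiff_fst.contDiffOn fun q hq => hq.2).prodMk
        (hΦu_smooth.mono inter_subset_left)) ?_ ?_ ⟨?_, hq₀S⟩
    · simp [Module.finrank_pi_fintype, mul_comm]
    · intro q hq v hv
      have h1 : HasFDerivAt (fun q : ProlongedSp n p × InputSp => (Φx q.1, Φu q))
          (((fderiv ℝ Φx q.1).comp (ContinuousLinearMap.fst ℝ _ _)).prod
            (ContinuousLinearMap.pi fun i => (fderiv ℝ (G i) (lift q)).comp (jetIncl n N p))) q :=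
        (((hΦx_smooth.differentiableAt_of_isOpen hS hq.2).hasFDerivAt).comp q
          hasFDerivAt_fst).prodMk (hasFDerivAt_pi.2 fun i =>
            ((hdiff (h.smooth_input i) _ hq.1).hasFDerivAt).comp q (hasFDerivAt_jetLift hp ξ q))
      replace hv : fderiv ℝ (fun q : ProlongedSp n p × InputSp => (Φx q.1, Φu q)) q v = 0 := hv
      rw [h1.fderiv] at hv
      obtain ⟨v, t⟩ := v
      have hv0 : v = 0 := hΦx_inj q.1 hq.2 v (congrArg Prod.fst hv)
      subst hv0
      have ht : t = 0 := h.input_inj (lift q) hq.1 t fun i => by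
        rw [← jetIncl_zero_left]
        exact congrFun (congrArg Prod.snd hv) i
      rw [ht]; rfl
    · show lift q₀ ∈ V
      rwa [hlift₀]
  · have hQ : IsOpen (lift ⁻¹' V ∩ Prod.fst ⁻¹' e.source) :=
      (hV.preimage hlift_smooth.continuous).inter (e.open_source.preimage continuous_fst)
    have hmem : q₀ ∈ lift ⁻¹' V ∩ Prod.fst ⁻¹' e.source :=
      ⟨by show lift q₀ ∈ V; rwa [hlift₀], hq₀e⟩
    filter_upwards [hQ.mem_nhds hmem] with q hq
    have hη : lift q ∈ V := hq.1
    have hs : sec q.1 ∈ V := heS hq.2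
    have hfst : (sec q.1).1 = (lift q).1 := by
      rw [show sec q.1 = jetLift hp ξ (q.1, q₀.2) from rfl,
        show lift q = jetLift hp ξ q from rfl, jetLift_fst, jetLift_fst]
    have hsnd : ∀ l < p, jetU l (sec q.1) = jetU l (lift q) := fun l hl => by
      rw [show sec q.1 = jetLift hp ξ (q.1, q₀.2) from rfl,
        show lift q = jetLift hp ξ q from rfl, jetU_jetLift hp ξ _ hl.le,
        jetU_jetLift hp ξ _ hl.le, inputSeq_of_lt _ hl, inputSeq_of_lt _ hl]
    have heq : ∀ {K : JetSp n N → ℝ}, ContDiffOn ℝ ∞ K V → HasOrd K p V →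
        K (sec q.1) = K (lift q) := fun hK ho =>
      ho.eq_of_coords hVc (hdiff hK) hs hη hfst hsnd
    have hψ : e.symm (Φx q.1) = q.1 := by rw [← heΦ]; exact e.left_inv hq.2
    funext i
    -- The prolonged field and the total field agree in x, u, …, u_[p-1], which is all that a
    -- coordinate of order p sees.
    have hlie : fderiv ℝ Φx q.1 (prolong f p q) i = lieD (totalField f N) (H i) (lift q) := by
      rw [hΦx_deriv q.1 hs, (h.order_coord i).fderiv_eq_of_coords hVc hV
        (hdiff (h.smooth_coord i)) hs hη hfst hsnd, lieD, ← sub_eq_zero, ← map_sub]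
      refine h.order_coord i _ hη _ ?_ fun l hl => ?_
      · rw [Prod.fst_sub, jetIncl_fst, prolong_fst, sub_eq_zero]
        show f (q.1.1, inputSeq q 0) = f ((lift q).1, (lift q).2 0)
        rw [← jetU_zero, show lift q = jetLift hp ξ q from rfl, jetLift_fst,
          jetU_jetLift hp ξ _ (Nat.zero_le p)]
      · rw [map_sub, jetU_jetIncl _ (by omega), inputSeq_prolong _ _ hl, jetU_totalField,
          show lift q = jetLift hp ξ q from rfl, jetU_jetLift hp ξ _ hl, sub_self]
    rw [hlie, h.dynamics _ hη i]
    simp only [gtfField, hψ]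
    split_ifs
    · rfl
    · exact (heq (h.smooth_coord _) (h.order_coord _)).symm
    · rw [heq (h.smooth_left i) (h.order_left i), heq (h.smooth_right i) (h.order_right i)]
    · rfl
  · have hfst : ∀ s, (sec s).1 = s.1 := fun s => jetLift_fst hp ξ _
    refine Eventually.of_forall fun s i => ⟨fun hi => ?_, fun hi => ?_⟩
    · show H i (sec s) = _
      rw [(h.coord_out i).1 hi, ← hfst s]; rfl
    · show H i (sec s) = _
      rw [(h.coord_out i).2 hi, ← hfst s]; rfl

theorem IsGTFSystem.isSFEToGTFAt {k₁ k₂ : ℕ} {H A B : Fin (n + 2 * p) → JetSp n N → ℝ}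
    {G : Fin 2 → JetSp n N → ℝ} (h : IsGTFSystem f φ p k₁ k₂ H G A B V) (hV : IsOpen V)
    (hp : p ≤ N) {ξ : JetSp n N} (hξ : ξ ∈ V) : IsSFEToGTFAt f φ p (ξ.trunc p hp) := by
  obtain ⟨r, hr, hrV⟩ := Metric.isOpen_iff.1 hV ξ hξ
  exact (h.mono hrV).isSFEToGTFAt_of_convex Metric.isOpen_ball (convex_ball ξ r) hp
    (Metric.mem_ball_self hr)

end Assembly

/-! ### The general triangular form of a prolonged flat system -/

section Coordinates

variable {n N : ℕ} {f : StateSp n × InputSp → StateSp n} {φ : StateSp n → Fin 2 → ℝ}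
  {R κ : Fin 2 → ℕ} {e : ℕ} {c c' : Fin 2} {V : Set (JetSp n N)} {i₀ p : ℕ}

/-- The coordinates `φ¹_[0,κ+p-1], φ²_[0,κ+p-1], u^c_[p-e], …, u^c_[p-1]`. -/
noncomputable def triCoord (f : StateSp n × InputSp → StateSp n) (φ : StateSp n → Fin 2 → ℝ)
    (κ : Fin 2 → ℕ) (e : ℕ) (c : Fin 2) (p i : ℕ) : JetSp n N → ℝ :=
  if i < κ 0 + p then outDeriv f N φ 0 i
  else if i < κ 0 + p + (κ 1 + p) then outDeriv f N φ 1 (i - (κ 0 + p))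
  else inputJet c (p - e + (i - (κ 0 + p + (κ 1 + p))))

theorem triCoord_left {k : ℕ} (hk : k < κ 0 + p) :
    (triCoord f φ κ e c p k : JetSp n N → ℝ) = outDeriv f N φ 0 k := if_pos hk

theorem triCoord_right {k : ℕ} (hk : k < κ 1 + p) :
    (triCoord f φ κ e c p (κ 0 + p + k) : JetSp n N → ℝ) = outDeriv f N φ 1 k := by
  rw [triCoord, if_neg (by omega), if_pos (by omega), Nat.add_sub_cancel_left]

theorem triCoord_input (l : ℕ) :
    (triCoord f φ κ e c p (κ 0 + p + (κ 1 + p) + l) : JetSp n N → ℝ) =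
      inputJet c (p - e + l) := by
  rw [triCoord, if_neg (by omega), if_neg (by omega), Nat.add_sub_cancel_left]

/-- The ratio of the derivatives of `φ²_[κ]` and `φ¹_[κ]` with respect to the input. -/
noncomputable def inputRatio (f : StateSp n × InputSp → StateSp n) (φ : StateSp n → Fin 2 → ℝ)
    (κ : Fin 2 → ℕ) (c' : Fin 2) (η : JetSp n N) : ℝ :=
  inputDeriv f φ 1 (κ 1) η (Pi.single c' 1) / inputDeriv f φ 0 (κ 0) η (Pi.single c' 1)

/-- The difference `φ²_[κ+p] - r φ¹_[κ+p]`, where `r` is the ratio of the input derivatives. -/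
noncomputable def reducedOut (f : StateSp n × InputSp → StateSp n) (φ : StateSp n → Fin 2 → ℝ)
    (κ : Fin 2 → ℕ) (c' : Fin 2) (p : ℕ) (η : JetSp n N) : ℝ :=
  outDeriv f N φ 1 (κ 1 + p) η - inputRatio f φ κ c' η * outDeriv f N φ 0 (κ 0 + p) η

namespace IsRegularDomain

theorem contDiffOn_inputDeriv (h : IsRegularDomain f φ R κ e c c' V) (j : Fin 2) (t : InputSp) :
    ContDiffOn ℝ ∞ (fun η => inputDeriv f φ j (κ j) η t) V :=
  contDiffOn_fderiv_apply h.dom.isOpen (h.dom.outDeriv j _) _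

theorem hasOrd_inputDeriv (h : IsRegularDomain f φ R κ e c c' V) (j : Fin 2) (t : InputSp) :
    HasOrd (fun η => inputDeriv f φ j (κ j) η t) 1 V :=
  HasOrd.fderiv_apply h.dom.isOpen (h.dom.outDeriv j _)
    ((h.free j).hasOrd h.dom (h.one_le j) 0) _

theorem contDiffOn_inputRatio (h : IsRegularDomain f φ R κ e c c' V) :
    ContDiffOn ℝ ∞ (inputRatio f φ κ c') V :=
  (h.contDiffOn_inputDeriv 1 _).div (h.contDiffOn_inputDeriv 0 _) h.lead

theorem hasOrd_inputRatio (h : IsRegularDomain f φ R κ e c c' V) :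
    HasOrd (inputRatio f φ κ c') 1 V := by
  intro η hη v hv hl
  have h0 := h.hasOrd_inputDeriv 0 (Pi.single c' 1) η hη v hv hl
  have h1 := h.hasOrd_inputDeriv 1 (Pi.single c' 1) η hη v hv hl
  have hev : (fun ζ => inputDeriv f φ 1 (κ 1) ζ (Pi.single c' 1)) =ᶠ[𝓝 η] fun ζ =>
      inputRatio f φ κ c' ζ * inputDeriv f φ 0 (κ 0) ζ (Pi.single c' 1) := by
    filter_upwards [h.dom.isOpen.mem_nhds hη] with ζ hζ
    rw [inputRatio, div_mul_cancel₀ _ (h.lead ζ hζ)]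
  rw [hev.fderiv_eq, fderiv_fun_mul
    (h.contDiffOn_inputRatio.differentiableAt_of_isOpen h.dom.isOpen hη)
    ((h.contDiffOn_inputDeriv 0 _).differentiableAt_of_isOpen h.dom.isOpen hη)] at h1
  simp only [add_apply, smul_apply, smul_eq_mul, h0, mul_zero, zero_add] at h1
  exact (mul_eq_zero.1 h1).resolve_left (h.lead η hη)

theorem inputDeriv_one_eq (h : IsRegularDomain f φ R κ e c c' V) (he : 1 ≤ e) {η : JetSp n N}
    (hη : η ∈ V) : inputRatio f φ κ c' η ≠ 0 ∧ ∀ t,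
      inputDeriv f φ 1 (κ 1) η t = inputRatio f φ κ c' η * inputDeriv f φ 0 (κ 0) η t := by
  obtain ⟨r, hr, hrt⟩ := h.exists_ratio he hη
  have : inputRatio f φ κ c' η = r := by
    rw [inputRatio, hrt, mul_div_cancel_right₀ _ (h.lead η hη)]
  rw [this]
  exact ⟨hr, hrt⟩

theorem contDiffOn_reducedOut (h : IsRegularDomain f φ R κ e c c' V) :
    ContDiffOn ℝ ∞ (reducedOut f φ κ c' p) V :=
  (h.dom.outDeriv 1 _).sub (h.contDiffOn_inputRatio.mul (h.dom.outDeriv 0 _))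

theorem fderiv_reducedOut (h : IsRegularDomain f φ R κ e c c' V) {η : JetSp n N} (hη : η ∈ V)
    (v : JetSp n N) : fderiv ℝ (reducedOut f φ κ c' p) η v =
      fderiv ℝ (outDeriv f N φ 1 (κ 1 + p)) η v -
      inputRatio f φ κ c' η * fderiv ℝ (outDeriv f N φ 0 (κ 0 + p)) η v -
      fderiv ℝ (inputRatio f φ κ c') η v * outDeriv f N φ 0 (κ 0 + p) η := by
  have hd : ∀ {K : JetSp n N → ℝ}, ContDiffOn ℝ ∞ K V → HasFDerivAt K (fderiv ℝ K η) η :=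
    fun hK => (hK.differentiableAt_of_isOpen h.dom.isOpen hη).hasFDerivAt
  have h1 : HasFDerivAt (reducedOut f φ κ c' p) _ η :=
    (hd (h.dom.outDeriv 1 (κ 1 + p))).sub
      ((hd h.contDiffOn_inputRatio).mul (hd (h.dom.outDeriv 0 (κ 0 + p))))
  rw [h1.fderiv]
  simp
  ring

/-- The leading terms in u_[p] cancel because ∂φ²_[κ₂]/∂u = r ∂φ¹_[κ₁]/∂u. The ratio r may itself
depend on u, which is harmless as p ≥ e ≥ 1. -/
theorem hasOrd_reducedOut (h : IsRegularDomain f φ R κ e c c' V) (he : 1 ≤ e) (hpe : e ≤ p)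
    (hp : p ≤ N) : HasOrd (reducedOut f φ κ c' p) p V := by
  intro η hη v hv hl
  rw [h.fderiv_reducedOut hη, h.fderiv_lead 1 hp hη hv hl, h.fderiv_lead 0 hp hη hv hl,
    (h.inputDeriv_one_eq he hη).2, h.hasOrd_inputRatio η hη v hv fun l hl' => hl l (by omega)]
  ring

theorem hasOrd_triCoord (h : IsRegularDomain f φ R κ e c c' V) {i : ℕ}
    (hi : i < κ 0 + p + (κ 1 + p) + e) (hpe : e ≤ p) :
    HasOrd (triCoord f φ κ e c p i) p V := by
  unfold triCoord
  split_ifs with h1 h2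
  · exact (h.free 0).hasOrd_of_lt h.dom (h.one_le 0) h1
  · exact (h.free 1).hasOrd_of_lt h.dom (h.one_le 1) (by omega)
  · exact (hasOrd_inputJet c _).mono_order (by omega)

theorem contDiffOn_triCoord (h : IsRegularDomain f φ R κ e c c' V) (i : ℕ) :
    ContDiffOn ℝ ∞ (triCoord f φ κ e c p i) V := by
  unfold triCoord
  split_ifs with h1 h2
  · exact h.dom.outDeriv 0 _
  · exact h.dom.outDeriv 1 _
  · exact (contDiff_inputJet c _).contDiffOn

/-- For i₀ = 0 the derivatives reach order R_j - 1 and fix x; for i₀ = 1 they reach R_j and fix u as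
well. -/
theorem state_eq_zero (h : IsRegularDomain f φ R κ e c c' V) (hp : p = e + i₀) (hi₀ : i₀ ≤ 1)
    {η : JetSp n N} (hη : η ∈ V) {v : JetSp n N}
    (h0 : ∀ k < κ 0 + p, fderiv ℝ (outDeriv f N φ 0 k) η v = 0)
    (h1 : ∀ k < κ 1 + p, fderiv ℝ (outDeriv f N φ 1 k) η v = 0) :
    v.1 = 0 ∧ ∀ l < i₀, jetU l v = 0 := by
  have hR0 := h.order 0
  have hR1 := h.order 1
  refine ⟨(h.flat η hη).state v fun j k hk => ?_, fun l hl => ?_⟩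
  · fin_cases j
    · exact h0 k (show k < _ by have : k < R 0 := hk; omega)
    · exact h1 k (show k < _ by have : k < R 1 := hk; omega)
  · obtain rfl : l = 0 := by omega
    refine (h.flat η hη).input_eq_zero fun j k hk => ?_
    fin_cases j
    · exact h0 k (show k < _ by have : k ≤ R 0 := hk; omega)
    · exact h1 k (show k < _ by have : k ≤ R 1 := hk; omega)

/-- This supplies the regularity and the dependence condition at the first non-integrator: u^c_[i₀]
is the one further coordinate that enters. -/
theorem fderiv_out_one_sub (h : IsRegularDomain f φ R κ e c c' V) (he : 1 ≤ e)
    (hp : p = e + i₀) (hi₀ : i₀ ≤ 1) (hpN : p ≤ N) {η : JetSp n N} (hη : η ∈ V) :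
    ∃ γ : ℝ, γ ≠ 0 ∧ ∀ v, (∀ k < κ 0 + p, fderiv ℝ (outDeriv f N φ 0 k) η v = 0) →
      (∀ k < κ 1 + p, fderiv ℝ (outDeriv f N φ 1 k) η v = 0) →
      fderiv ℝ (outDeriv f N φ 1 (κ 1 + p)) η v -
        inputRatio f φ κ c' η * fderiv ℝ (outDeriv f N φ 0 (κ 0 + p)) η v =
        γ * jetU i₀ v c := by
  obtain ⟨γ, hγ0, hγ⟩ := h.isLeadingAt he (i := i₀) (by omega) η hη
  refine ⟨γ, hγ0, fun v h0 h1 => ?_⟩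
  obtain ⟨hv, hl⟩ := h.state_eq_zero hp hi₀ hη h0 h1
  set A := inputDeriv f φ 0 (κ 0) η with hA
  -- A correction in the direction u_[p] that makes dφ¹_[κ₁+p] vanish too; the combination φ²_[κ₂+p]
  -- - r φ¹_[κ₁+p] does not see it, and `isLeadingAt` applies.
  set t : InputSp := (-fderiv ℝ (outDeriv f N φ 0 (κ 0 + p)) η v / A (Pi.single c' 1)) •
    Pi.single c' 1
  have hAt : A t = -fderiv ℝ (outDeriv f N φ 0 (κ 0 + p)) η v := by
    rw [map_smul, smul_eq_mul, div_mul_cancel₀ _ (h.lead η hη)]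
  have hz : ∀ l < p, jetU l (jetSingle p t : JetSp n N) = 0 := fun l hl => by
    rw [jetU_jetSingle hpN, if_neg hl.ne]
  have htop : ∀ j, fderiv ℝ (outDeriv f N φ j (κ j + p)) η (jetSingle p t) =
      inputDeriv f φ j (κ j) η t := fun j => by
    rw [h.fderiv_lead j hpN hη rfl hz, jetU_jetSingle hpN, if_pos rfl]
  have hker : InKer f φ κ c (e + 1 + i₀) i₀ η (v + jetSingle p t) := by
    refine ⟨by simp [hv], fun l hl' => ?_, fun l hl' => ?_⟩
    · rcases Nat.lt_or_eq_of_le (show l ≤ p by omega) with hlt | rfl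
      · rw [map_add, h0 _ (by omega), zero_add]
        exact (h.free 0).hasOrd_of_lt h.dom (h.one_le 0) (i := p) (by omega) η hη _ rfl hz
      · rw [map_add, htop, hAt, add_neg_cancel]
    · rw [map_add, hl l hl', hz l (by omega)]
      simp
  have h2 := hγ _ hker
  rw [add_assoc, ← hp, map_add, htop, (h.inputDeriv_one_eq he hη).2, ← hA, hAt, map_add,
    hz i₀ (by omega), add_zero] at h2
  rw [← h2]
  ring

theorem jetU_eq_zero_of_input (h : IsRegularDomain f φ R κ e c c' V) (hp : p = e + i₀)
    (hi₀ : i₀ ≤ 1) (hpN : p ≤ N) {η : JetSp n N} (hη : η ∈ V) {v : JetSp n N}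
    (h0 : ∀ k < κ 0 + p, fderiv ℝ (outDeriv f N φ 0 k) η v = 0)
    (h1 : ∀ k < κ 1 + p, fderiv ℝ (outDeriv f N φ 1 k) η v = 0) {b : ℕ} (hb : b ≤ p)
    (hw : ∀ l, i₀ ≤ l → l < b → jetU l v c = 0) : ∀ l < b, jetU l v = 0 := by
  obtain ⟨hv, hl⟩ := h.state_eq_zero hp hi₀ hη h0 h1
  refine h.jetU_eq_zero hη (a := p) hb (by omega)
    ⟨hv, fun l hl' => h0 _ (by omega), fun l hl' => ?_⟩
  by_cases hli : l < i₀
  · rw [hl l hli]; rfl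
  · exact hw l (by omega) hl'

theorem exists_isGTFSystem (h : IsRegularDomain f φ R κ e c c' V) (hn : n = κ 0 + κ 1 + e)
    (hp : p = e + i₀) (hi₀ : i₀ ≤ 1) (hpN : p ≤ N) : ∃ k₁ k₂ H G A B,
      IsGTFSystem (N := N) f φ p k₁ k₂ H G A B V := by
  have hκ0 := h.one_le 0
  have hκ1 := h.one_le 1
  have hm : n + 2 * p = κ 0 + p + (κ 1 + p) + e := by omega
  have hpe : p - e = i₀ := by omega
  let H : Fin (n + 2 * p) → JetSp n N → ℝ := fun i => triCoord f φ κ e c p i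
  -- For e = 0 no input coordinates are appended, so the second chain ends in φ²_[κ₂+p]; otherwise
  -- the last coordinate is u^c_[p-1].
  let G : Fin 2 → JetSp n N → ℝ := ![outDeriv f N φ 0 (κ 0 + p),
    if e = 0 then outDeriv f N φ 1 (κ 1 + p) else inputJet c p]
  -- Only the equation after the two chains is nontrivial; beyond it the form is an integrator
  -- chain, with a^l = z^{l+1} and b^l = 0.
  let A : Fin (n + 2 * p) → JetSp n N → ℝ := fun i =>
    if (i : ℕ) + 1 = κ 0 + p + (κ 1 + p) ∧ 1 ≤ e then reducedOut f φ κ c' p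
    else if h : (i : ℕ) + 1 < n + 2 * p then H ⟨i + 1, h⟩ else fun _ => 0
  let B : Fin (n + 2 * p) → JetSp n N → ℝ := fun i =>
    if (i : ℕ) + 1 = κ 0 + p + (κ 1 + p) ∧ 1 ≤ e then inputRatio f φ κ c' else fun _ => 0
  have hH_left : ∀ {k} (hk : k < κ 0 + p), H ⟨k, by omega⟩ = outDeriv f N φ 0 k :=
    fun hk => triCoord_left hk
  have hH_right : ∀ {k} (hk : k < κ 1 + p), H ⟨κ 0 + p + k, by omega⟩ = outDeriv f N φ 1 k :=
    fun hk => triCoord_right hk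
  have hH_input : ∀ {l} (hl : l < e), H ⟨κ 0 + p + (κ 1 + p) + l, by omega⟩ =
      inputJet c (i₀ + l) := fun {l} hl => by
    have : H ⟨κ 0 + p + (κ 1 + p) + l, by omega⟩ = inputJet c (p - e + l) := triCoord_input l
    rwa [hpe] at this
  have hH_ord : ∀ i, HasOrd (H i) p V := fun i => h.hasOrd_triCoord (by omega) (by omega)
  have hH_smooth : ∀ i, ContDiffOn ℝ ∞ (H i) V := fun i => h.contDiffOn_triCoord i
  have hzero_ord : HasOrd (fun _ => 0 : JetSp n N → ℝ) p V := fun η _ v _ _ => by simp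
  -- vanishing of the differentials of the first coordinates
  have hlow : ∀ m : ℕ, κ 0 + p + (κ 1 + p) ≤ m + 1 → ∀ η v,
      (∀ j : Fin (n + 2 * p), (j : ℕ) ≤ m → fderiv ℝ (H j) η v = 0) →
      (∀ k < κ 0 + p, fderiv ℝ (outDeriv f N φ 0 k) η v = 0) ∧
      (∀ k < κ 1 + p, fderiv ℝ (outDeriv f N φ 1 k) η v = 0) := by
    intro m hmk η v hv
    refine ⟨fun k hk => ?_, fun k hk => ?_⟩
    · rw [← hH_left hk]; exact hv _ (show k ≤ m by omega)
    · rw [← hH_right hk]; exact hv _ (show κ 0 + p + k ≤ m by omega)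
  refine ⟨κ 0 + p, κ 1 + p, H, G, A, B, ⟨by omega, by omega, by omega, hH_smooth, hH_ord, ?_, ?_,
    ?_, ?_, ?_, ?_, ?_, ?_, ?_, ?_, ?_, ?_⟩⟩
  · intro i
    fin_cases i
    · exact h.dom.outDeriv 0 _
    · show ContDiffOn ℝ ∞ (if e = 0 then outDeriv f N φ 1 (κ 1 + p) else inputJet c p) V
      split_ifs
      · exact h.dom.outDeriv 1 _
      · exact (contDiff_inputJet c p).contDiffOn
  · intro i
    simp only [A]
    split_ifs
    · exact h.contDiffOn_reducedOut
    · exact hH_smooth _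
    · exact contDiffOn_const
  · intro i
    simp only [A]
    split_ifs with h1 h2
    · exact h.hasOrd_reducedOut h1.2 (by omega) hpN
    · exact hH_ord _
    · exact hzero_ord
  · intro i
    simp only [B]
    split_ifs
    · exact h.contDiffOn_inputRatio
    · exact contDiffOn_const
  · intro i
    simp only [B]
    split_ifs with h1
    · exact h.hasOrd_inputRatio.mono_order (by omega)
    · exact hzero_ord
  · intro η hη v hv
    obtain ⟨h0, h1⟩ := hlow (n + 2 * p) (by omega) η v fun j _ => hv j
    refine ⟨(h.state_eq_zero hp hi₀ hη h0 h1).1,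
      h.jetU_eq_zero_of_input hp hi₀ hpN hη h0 h1 le_rfl fun l hl hlp => ?_⟩
    have := hv ⟨κ 0 + p + (κ 1 + p) + (l - i₀), by omega⟩
    rwa [hH_input (by omega), fderiv_inputJet, Nat.add_sub_cancel' hl] at this
  · intro η hη t ht
    have hz : ∀ l < p, jetU l (jetSingle p t : JetSp n N) = 0 := fun l hl => by
      rw [jetU_jetSingle hpN, if_neg hl.ne]
    have htop : ∀ j, fderiv ℝ (outDeriv f N φ j (κ j + p)) η (jetSingle p t) =
        inputDeriv f φ j (κ j) η t := fun j => by
      rw [h.fderiv_lead j hpN hη rfl hz, jetU_jetSingle hpN, if_pos rfl]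
    have ht0 : inputDeriv f φ 0 (κ 0) η t = 0 := by rw [← htop]; exact ht 0
    have ht1 : fderiv ℝ (if e = 0 then outDeriv f N φ 1 (κ 1 + p) else inputJet c p) η
      (jetSingle p t) = 0 := ht 1
    split_ifs at ht1 with he
    · rw [htop] at ht1
      have h2 : jetU 0 (jetSingle 0 t : JetSp n N) = 0 :=
        (h.flat η hη).input_eq_zero fun j k hk => by
          rw [h.order j, he, add_zero] at hk
          rcases Nat.lt_or_eq_of_le hk with hlt | rfl
          · exact h.free j k hlt η hη _ rfl (by simp)
          · fin_cases j
            · exact ht0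
            · exact ht1
      rwa [jetU_jetSingle (Nat.zero_le N), if_pos rfl] at h2
    · rw [fderiv_inputJet, jetU_jetSingle hpN, if_pos rfl] at ht1
      exact h.input_eq_zero hη ht0 ht1
  · rintro ⟨i, hi⟩
    refine ⟨?_, ?_⟩
    · rintro rfl; exact hH_left (by omega)
    · rintro rfl; exact hH_right (k := 0) (by omega)
  · rintro η hη ⟨i, hi⟩
    dsimp only
    by_cases hi1 : i < κ 0 + p
    · rw [hH_left hi1, ← outDeriv_succ, dif_pos (by omega)]
      by_cases hi2 : i + 1 = κ 0 + p
      · rw [if_pos hi2, hi2]; rfl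
      · rw [if_neg hi2, if_pos (by omega), hH_left (by omega)]
    by_cases hi2 : i < κ 0 + p + (κ 1 + p)
    · obtain ⟨k, rfl⟩ := Nat.exists_eq_add_of_le (Nat.not_lt.1 hi1)
      rw [hH_right (by omega), ← outDeriv_succ]
      by_cases hk : k + 1 < κ 1 + p
      · rw [dif_pos (by omega), if_neg (by omega), if_pos (by omega)]
        exact congrFun (hH_right hk).symm η
      · have hk' : k + 1 = κ 1 + p := by omega
        by_cases he : e = 0
        · rw [dif_neg (by omega), hk']
          simp [G, he]
        · have hif : κ 0 + p + k + 1 = κ 0 + p + (κ 1 + p) ∧ 1 ≤ e := by omega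
          rw [dif_pos (by omega), if_neg (by omega), if_neg (by omega), hk']
          simp only [A, B, if_pos hif]
          show _ = reducedOut f φ κ c' p η +
            inputRatio f φ κ c' η * outDeriv f N φ 0 (κ 0 + p) η
          rw [reducedOut]
          ring
    · obtain ⟨l, rfl⟩ := Nat.exists_eq_add_of_le (Nat.not_lt.1 hi2)
      have he : e ≠ 0 := by omega
      rw [hH_input (by omega), lieD_inputJet]
      by_cases hl : l + 1 < e
      · have hif : ¬ (κ 0 + p + (κ 1 + p) + l + 1 = κ 0 + p + (κ 1 + p) ∧ 1 ≤ e) := by omega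
        have him : κ 0 + p + (κ 1 + p) + l + 1 < n + 2 * p := by omega
        rw [dif_pos him, if_neg (by omega), if_neg (by omega)]
        simp only [A, B, if_neg hif, dif_pos him, zero_mul, add_zero]
        exact congrFun (hH_input hl).symm η
      · rw [dif_neg (by omega), show i₀ + l + 1 = p by omega]
        simp [G, he]
  · intro i hi him η hη v hv
    have he : 1 ≤ e := by omega
    obtain ⟨h0, h1⟩ := hlow (i + 1) (by omega) η v hv
    by_cases hik : (i : ℕ) + 1 = κ 0 + p + (κ 1 + p)
    · simp only [A, B, if_pos (show (i : ℕ) + 1 = κ 0 + p + (κ 1 + p) ∧ 1 ≤ e from ⟨hik, he⟩)]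
      obtain ⟨γ, -, hγ⟩ := h.fderiv_out_one_sub he hp hi₀ hpN hη
      have hw : jetU i₀ v c = 0 := by
        have := hv ⟨κ 0 + p + (κ 1 + p) + 0, by omega⟩ (by simp only; omega)
        rwa [hH_input (by omega), fderiv_inputJet] at this
      have hu := h.jetU_eq_zero_of_input hp hi₀ hpN hη h0 h1 (b := i₀ + 1) (by omega)
        fun l hl hl' => by rwa [show l = i₀ by omega]
      have hratio := h.hasOrd_inputRatio η hη v (h.state_eq_zero hp hi₀ hη h0 h1).1
        fun l hl => hu l (by omega)
      refine ⟨?_, hratio⟩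
      rw [h.fderiv_reducedOut hη, hγ v h0 h1, hw, hratio]
      ring
    · simp only [A, B, hik, false_and, if_false, him, dite_true]
      exact ⟨hv _ le_rfl, by simp⟩
  · intro i him hi η hη v hv hv1
    have he : 1 ≤ e := by omega
    obtain ⟨h0, h1⟩ := hlow i (by omega) η v hv
    by_cases hik : (i : ℕ) + 1 = κ 0 + p + (κ 1 + p)
    · simp only [A, B, if_pos (show (i : ℕ) + 1 = κ 0 + p + (κ 1 + p) ∧ 1 ≤ e from ⟨hik, he⟩)]
      obtain ⟨γ, hγ0, hγ⟩ := h.fderiv_out_one_sub he hp hi₀ hpN hη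
      have hw : jetU i₀ v c = 1 := by
        have h2 := hH_input (l := 0) (by omega)
        simp only [add_zero, ← hik] at h2
        rwa [h2, fderiv_inputJet] at hv1
      by_contra! hcon
      rw [h.fderiv_reducedOut hη, hγ v h0 h1, hw, hcon.2] at hcon
      simp at hcon
      exact hγ0 hcon
    · left
      simp only [A, hik, false_and, if_false, him, dite_true]
      rw [hv1]
      exact one_ne_zero
  · intro i hi him η hη
    have he : 1 ≤ e := by omega
    simp only [B, if_pos (show (i : ℕ) + 1 = κ 0 + p + (κ 1 + p) ∧ 1 ≤ e from ⟨hi.symm, he⟩)]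
    exact (h.inputDeriv_one_eq he hη).1

end IsRegularDomain

end Coordinates

/-! ### Main theorem -/

theorem theorem2 {n N : ℕ} (f : StateSp n × InputSp → StateSp n) (φ : StateSp n → Fin 2 → ℝ)
    (Ω : Set (StateSp n × InputSp)) (hΩ : IsOpen Ω) (hf : ContDiffOn ℝ ∞ f Ω)
    (hφ : ContDiffOn ℝ ∞ φ (Prod.fst '' Ω))
    (W : Set (JetSp n N)) (hW : IsOpen W) (hne : W.Nonempty)
    (hWΩ : ∀ ξ ∈ W, (ξ.1, ξ.2 0) ∈ Ω)
    (R : Fin 2 → ℕ) (hflat : IsXFlatOutput f φ R W) :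
    ∃ d : ℕ, (d : ℤ) = differentialDifference n R ∧ d + 2 ≤ n ∧
      (IsControlAffineOn f Ω → IsGenericallySFEToGTF f φ d W) ∧
      IsGenericallySFEToGTF f φ (d + 1) W := by
  obtain ⟨hR, O, ⟨hO, hOW, hWO⟩, hOflat⟩ := hflat
  have hΩ' : IsOpen (Prod.fst '' Ω) := isOpenMap_fst _ hΩ
  have hmem : ∀ ξ ∈ W, ξ.1 ∈ Prod.fst '' Ω := fun ξ hξ => ⟨_, hWΩ ξ hξ, rfl⟩
  have hdomW : IsSmoothDomain f φ W := by
    refine ⟨hW, ?_, fun η hη => hf.differentiableAt_of_isOpen hΩ (hWΩ η hη), ?_,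
      fun η hη => hφ.differentiableAt_of_isOpen hΩ' (hmem η hη)⟩
    · exact hf.comp (ContDiff.contDiffOn (f := fun η : JetSp n N => (η.1, η.2 0)) (by fun_prop))
        hWΩ
    · exact hφ.comp contDiff_fst.contDiffOn hmem
  -- Regular domains occur in every open set meeting W, which is what density of the good points
  -- requires.
  have hreg : ∀ U : Set (JetSp n N), IsOpen U → (U ∩ W).Nonempty → ∃ V ⊆ U ∩ W, V.Nonempty ∧
      ∃ κ e c c', IsRegularDomain f φ R κ e c c' V := by
    rintro U hU ⟨ξ, hξU, hξW⟩
    obtain ⟨η, hηU, hηO⟩ := mem_closure_iff.1 (hWO hξW) U hU hξU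
    have hdom := hdomW.mono (hU.inter hO) (inter_subset_right.trans hOW)
    obtain ⟨V, hV, hVne, hκ⟩ := exists_isRegularDomain hdom ⟨η, hηU, hηO⟩
      (fun ζ hζ => (hOflat ζ hζ.2).isInfinitesimallyFlatAt hdom hζ) hR
    exact ⟨V, fun ζ hζ => ⟨(hV hζ).1, hOW (hV hζ).2⟩, hVne, hκ⟩
  obtain ⟨V, -, hVne, κ, d, c, c', hV⟩ := hreg univ isOpen_univ (by rwa [univ_inter])
  have hsum := hV.sum_order hVne
  have hdN := hV.add_one_le
  have hgen : ∀ i₀ ≤ 1, IsGenericallySFEToGTF f φ (d + i₀) W := by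
    intro i₀ hi₀
    have hp : d + i₀ ≤ N := by omega
    refine ⟨hp, interior {ξ ∈ W | IsSFEToGTFAt f φ (d + i₀) (ξ.trunc (d + i₀) hp)},
      ⟨isOpen_interior, fun ξ hξ => (interior_subset hξ).1, fun ξ hξ => ?_⟩,
      fun ξ hξ => (interior_subset hξ).2⟩
    refine mem_closure_iff.2 fun U hU hξU => ?_
    obtain ⟨V', hV'U, ⟨η, hη⟩, κ', d', c₁, c₁', hV'⟩ := hreg U hU ⟨ξ, hξU, hξ⟩
    have hsum' := hV'.sum_order ⟨η, hη⟩
    -- The relative degrees may differ between regular domains, but e is determined by R and n.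
    obtain rfl : d' = d := by omega
    have h0 := hV'.order 0
    have h1 := hV'.order 1
    obtain ⟨k₁, k₂, H, G, A, B, hsys⟩ := hV'.exists_isGTFSystem (by omega) rfl hi₀ hp
    have hsub : V' ⊆ {ξ ∈ W | IsSFEToGTFAt f φ (d' + i₀) (ξ.trunc (d' + i₀) hp)} := fun ζ hζ =>
      ⟨(hV'U hζ).2, hsys.isSFEToGTFAt hV'.dom.isOpen hp hζ⟩
    exact ⟨η, (hV'U hη).1, interior_maximal hsub hV'.dom.isOpen hη⟩
  have h0 := hV.order 0
  have h1 := hV.order 1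
  have hκ0 := hV.one_le 0
  have hκ1 := hV.one_le 1
  refine ⟨d, ?_, by omega, fun _ => hgen 0 (Nat.zero_le 1), hgen 1 le_rfl⟩
  rw [differentialDifference, Fin.sum_univ_two]
  omega
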